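/- For even $n$, let $V_1=\{1,\dots,n/2\}$ and $V_2=\{n/2+1,\dots,n\}$. Let $\mathcal E_I$ be the set of pairs $(i,j)$ with $i<j$ and $i,j$ both in $V_1$ or both in $V_2$, and let $\mathcal E_E=V_1\times V_2$. Let $p_n\in(0,1]$ and $\alpha_n\in[0,1]$ be sequences with $np_n\to\infty$ and $\alpha_n\to\hat\alpha\in[0,1]$. On a probability space $(\Omega,\mathbb P)$, for each even $n$, let $(\xi_{ij})_{(i,j)\in\mathcal E_I}$ and $(\zeta_{ij})_{(i,j)\in\mathcal E_E}$ be jointly independent Bernoulli random variables, with parameter $p_n$ for each $\xi_{ij}$ and $\alpha_np_n$ for each $\zeta_{ij}$. For $\sigma\in\{-1,+1\}^n$ set $$H_n(\sigma)=-\frac1{np_n}\Big\{\sum_{(i,j)\in\mathcal E_I}\xi_{ij}\sigma_i\sigma_j+\sum_{(i,j)\in\mathcal E_E}\zeta_{ij}\sigma_i\sigma_j\Big\},\qquad \mu_{n,\beta}(\sigma)=\frac{e^{-\beta H_n(\sigma)}}{\sum_{\tau\in\{-1,+1\}^n}e^{-\beta H_n(\tau)}},$$ and let $\mathbf m^{(n)}(\sigma)=\big(\frac{2}{n}\sum_{j\in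 V_1}\sigma_j,\ \frac{2}{n}\sum_{j\in V_2}\sigma_j\big)$. Let $\beta_c=\frac{2}{1+\hat\alpha}$ and $0<\beta<\beta_c$. Then the matrix $$\Sigma=\frac{2-\beta}{(1-\beta)+\frac{\beta^2(1-\hat\alpha^2)}{4}}\begin{pmatrix}1&\frac{\beta\hat\alpha}{2-\beta}\\ \frac{\beta\hat\alpha}{2-\beta}&1\end{pmatrix}$$ is positive semidefinite and, as $n\to\infty$ along the even integers, the (random) law of $\sqrt n\,\mathbf m^{(n)}$ under $\mu_{n,\beta}$ converges in $\mathbb P$-probability to the bivariate normal law $\mathcal N(0,\Sigma)$. That is, for every neighbourhood $U$ of $\mathcal N(0,\Sigma)$ in the weak topology on probability measures on $\mathbb R^2$, the $\mathbb P$-probability that this law is not in $U$ tends to $0$. -/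

import Mathlib

open MeasureTheory ProbabilityTheory Filter Topology

noncomputable section

namespace BlockIsing

/-- Spin configurations on the vertex set `Fin n`; the two units of `ℤ` are `1` and `-1`. -/
abbrev Config (n : ℕ) : Type := Fin n → ℤˣ

instance : MeasurableSingletonClass ℤˣ :=
  ⟨fun u => ⟨{(u : ℤ)}, measurableSet_singleton _, by ext v; simp [Units.ext_iff]⟩⟩

/-- The value of the spin at `i`, as a real number. -/
def spin {n : ℕ} (σ : Config n) (i : Fin n) : ℝ := ((σ i : ℤ) : ℝ)

/-- The first community: the first `n / 2` vertices (`n` is even in all uses). -/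
def community₁ (n : ℕ) : Finset (Fin n) := Finset.univ.filter fun i => i.val < n / 2

/-- The second community: the other vertices. -/
def community₂ (n : ℕ) : Finset (Fin n) := Finset.univ.filter fun i => n / 2 ≤ i.val

/-- Internal edges: pairs `i < j` in the same community. -/
def internalEdges (n : ℕ) : Finset (Fin n × Fin n) :=
  Finset.univ.filter fun e => e.1 < e.2 ∧
    ((e.1 ∈ community₁ n ∧ e.2 ∈ community₁ n) ∨ (e.1 ∈ community₂ n ∧ e.2 ∈ community₂ n))

/-- External edges: pairs with one vertex in each community. -/
def externalEdges (n : ℕ) : Finset (Fin n × Fin n) := community₁ n ×ˢ community₂ n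

/-- The edge indicators `ξ` (internal) and `ζ` (external) of the two-community stochastic block
model on `n` vertices: jointly independent Bernoulli variables, with parameter `p` for the
internal edges and `α * p` for the external ones. -/
structure IsBlockModel {Ω : Type*} [MeasurableSpace Ω] (P : Measure Ω) (n : ℕ)
    (p α : unitInterval) (ξ : internalEdges n → Ω → ℝ) (ζ : externalEdges n → Ω → ℝ) : Prop where
  internal_law : ∀ e, HasLaw (ξ e) (bernoulliMeasure (1 : ℝ) 0 p) P
  external_law : ∀ e, HasLaw (ζ e) (bernoulliMeasure (1 : ℝ) 0 (α * p)) P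
  indep : iIndepFun (Sum.elim ξ ζ) P

/-- The Hamiltonian of the Ising model on the graph with edge indicators `x` (internal edges)
and `z` (external edges). -/
def hamiltonian (n : ℕ) (p : ℝ) (x : internalEdges n → ℝ) (z : externalEdges n → ℝ)
    (σ : Config n) : ℝ :=
  -(1 / (n * p)) *
    (∑ e, x e * spin σ e.1.1 * spin σ e.1.2 + ∑ e, z e * spin σ e.1.1 * spin σ e.1.2)

/-- The partition function. -/
def partitionFunction (n : ℕ) (p β : ℝ) (x : internalEdges n → ℝ) (z : externalEdges n → ℝ) : ℝ :=
  ∑ σ : Config n, Real.exp (-β * hamiltonian n p x z σ)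

/-- The Gibbs weight of a configuration. -/
def gibbsWeight (n : ℕ) (p β : ℝ) (x : internalEdges n → ℝ) (z : externalEdges n → ℝ)
    (σ : Config n) : ℝ :=
  Real.exp (-β * hamiltonian n p x z σ) / partitionFunction n p β x z

theorem partitionFunction_pos (n : ℕ) (p β : ℝ) (x : internalEdges n → ℝ)
    (z : externalEdges n → ℝ) : 0 < partitionFunction n p β x z :=
  Finset.sum_pos (fun _ _ => Real.exp_pos _) Finset.univ_nonempty

/-- The Gibbs probability measure on the configurations. -/
def gibbs (n : ℕ) (p β : ℝ) (x : internalEdges n → ℝ) (z : externalEdges n → ℝ) :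
    ProbabilityMeasure (Config n) :=
  ⟨∑ σ : Config n, ENNReal.ofReal (gibbsWeight n p β x z σ) • Measure.dirac σ, ⟨by
    have hZ := partitionFunction_pos n p β x z
    simp only [Measure.coe_finsetSum, Finset.sum_apply, Measure.smul_apply, measure_univ,
      smul_eq_mul, mul_one]
    rw [← ENNReal.ofReal_sum_of_nonneg
      (f := gibbsWeight n p β x z) (fun σ _ => div_nonneg (Real.exp_pos _).le hZ.le)]
    simp only [gibbsWeight]
    rw [← Finset.sum_div, ← partitionFunction, div_self hZ.ne', ENNReal.ofReal_one]⟩⟩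

/-- The magnetization vector of the two communities. -/
def magnetization (n : ℕ) (σ : Config n) : EuclideanSpace ℝ (Fin 2) :=
  !₂[1 / ((n : ℝ) / 2) * ∑ i ∈ community₁ n, spin σ i,
    1 / ((n : ℝ) / 2) * ∑ i ∈ community₂ n, spin σ i]

/-- The law of `√n • m` under the Gibbs measure, `m` the magnetization vector. -/
def scaledMagnetizationLaw (n : ℕ) (p β : ℝ) (x : internalEdges n → ℝ)
    (z : externalEdges n → ℝ) : ProbabilityMeasure (EuclideanSpace ℝ (Fin 2)) :=
  (gibbs n p β x z).map (f := fun σ => Real.sqrt n • magnetization n σ)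
    (measurable_of_finite _).aemeasurable

/-- The critical inverse temperature. -/
def criticalBeta (a : ℝ) : ℝ := 2 / (1 + a)

/-- The limiting covariance matrix. -/
def limitCov (β a : ℝ) : Matrix (Fin 2) (Fin 2) ℝ :=
  ((2 - β) / ((1 - β) + β ^ 2 * (1 - a ^ 2) / 4)) •
    !![1, β * a / (2 - β);
       β * a / (2 - β), 1]

/-- The centered Gaussian law with covariance matrix `S`, as a probability measure. -/
def centeredGaussian (S : Matrix (Fin 2) (Fin 2) ℝ) :
    ProbabilityMeasure (EuclideanSpace ℝ (Fin 2)) :=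
  ⟨multivariateGaussian 0 S, inferInstance⟩

/-- Convergence in probability of random probability measures `L k` to a deterministic one `ν`:
every neighbourhood of `ν` in the topology of weak convergence contains `L k`, except on an event
whose probability tends to `0` as `k → ∞`. -/
def TendstoInProbability {Ω E : Type*} [MeasurableSpace Ω] [TopologicalSpace E]
    [MeasurableSpace E] [OpensMeasurableSpace E] (P : Measure Ω)
    (L : ℕ → Ω → ProbabilityMeasure E) (ν : ProbabilityMeasure E) : Prop :=
  ∀ U ∈ 𝓝 ν, Tendsto (fun k => P {ω | L k ω ∉ U}) atTop (𝓝 0)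

end BlockIsing

end

noncomputable section

namespace BlockIsing

open scoped NNReal ENNReal

/-! The proof is a second-moment argument applied after a high-temperature expansion. Put `t = tanh
(β / (n p))`. For an edge indicator `ε ∈ {0, 1}` and a spin product `y = ±1`, the Boltzmann factor
is `1 + t ε y` times a factor that does not depend on the spins (`exp_mul_eq_cosh_mul`). The Gibbs
measure is therefore proportional to `quenchedWeight` (`gibbsWeight_eq_quenchedWeight_div`). This
discards the `cosh` factors, whose random product need not concentrate when only `n p → ∞` is known.

The mean of `quenchedWeight` is a product of factors `1 + s y`, with `s = p t` or `α p t`. Rewriting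
these through `artanh` gives a block Curie-Weiss weight, a constant times `exp (quadForm c d (√n
m))`, where `c → β (1 + a) / 4` and `d → β (1 - a) / 4` (`exists_annealedWeight_eq`). For
independent fair spins, `√n m` tends to the law of `(u + v, u - v)` with `u`, `v` independent
standard Gaussians (`tendsto_uniformLaw`). The tilt multiplies their density by `exp (c u² + d v²)`,
which changes the variances to `1 / (1 - 2c)` and `1 / (1 - 2d)`, and this is `N(0, Σ)`. The
condition `2c < 1` is exactly `β < β_c`. The tilt is unbounded, so a uniform exponential moment is
needed; it comes from a Hubbard-Stratonovich bound.

For concentration, the second moment at two replicas `σ`, `τ` exceeds the product of the means by at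
most a factor `exp (O(1 / (n p)) (1 + n |m(σ τ)|²))` (`prod_pairFactor_le`). Its average under the
annealed weights tends to `1`, so the relative variance vanishes (`tendsto_relativeVariance`).
Chebyshev's inequality, applied to the numerator and to the denominator of a Gibbs average, gives
convergence in probability. -/

/-! ### Weak convergence: random laws and unbounded test functions -/

/-- The sets `U` with `P (L k ∉ U) → 0` form a filter. Convergence in probability says that this
filter converges to `ν`, and convergence of filters in the weak topology is tested on one bounded
continuous function at a time. -/
theorem tendstoInProbability_of_forall_integral {Ω E : Type*} [MeasurableSpace Ω]
    [TopologicalSpace E] [MeasurableSpace E] [OpensMeasurableSpace E] (P : Measure Ω)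
    (L : ℕ → Ω → ProbabilityMeasure E) (ν : ProbabilityMeasure E)
    (h : ∀ f : BoundedContinuousFunction E ℝ, ∀ δ > 0,
      Tendsto (fun k => P {ω | δ ≤ |∫ x, f x ∂(L k ω : Measure E) - ∫ x, f x ∂(ν : Measure E)|})
        atTop (𝓝 0)) :
    TendstoInProbability P L ν := by
  let F : Filter (ProbabilityMeasure E) :=
    { sets := {U | Tendsto (fun k => P {ω | L k ω ∉ U}) atTop (𝓝 0)}
      univ_sets := by simp
      sets_of_superset := fun {U V} hU hUV =>
        tendsto_of_tendsto_of_tendsto_of_le_of_le tendsto_const_nhds hU (fun _ => zero_le)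
          fun k => measure_mono fun ω hω hω' => hω (hUV hω')
      inter_sets := fun {U V} hU hV => by
        have hUV := Tendsto.add (Set.mem_ofPred.1 hU) (Set.mem_ofPred.1 hV)
        rw [add_zero] at hUV
        refine tendsto_of_tendsto_of_tendsto_of_le_of_le tendsto_const_nhds hUV
          (fun _ => zero_le) fun k => ?_
        refine (measure_mono fun ω hω => ?_).trans (measure_union_le _ _)
        simpa [or_iff_not_imp_left] using hω }
  have hF : Tendsto id F (𝓝 ν) := by
    rw [ProbabilityMeasure.tendsto_iff_forall_integral_tendsto]
    intro f
    rw [Metric.tendsto_nhds]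
    intro δ hδ
    have := h f δ hδ
    change Tendsto _ _ _
    refine this.congr fun k => ?_
    congr 1
    ext ω
    simp [Real.dist_eq]
  intro U hU
  exact hF hU

theorem abs_integral_mul_sub_integral_mul_min_le {E : Type*} [TopologicalSpace E]
    [MeasurableSpace E] [OpensMeasurableSpace E] (ρ : Measure E) [IsProbabilityMeasure ρ]
    (f : BoundedContinuousFunction E ℝ) {h G : E → ℝ} (hc : Continuous h) (h0 : ∀ x, 0 ≤ h x)
    (G0 : ∀ x, 0 ≤ G x) {M δ C : ℝ} (hδ : 0 ≤ δ) (hdom : ∀ x, h x ≤ M + δ * G x)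
    (hGi : Integrable G ρ) (hG : ∫ x, G x ∂ρ ≤ C) :
    |∫ x, f x * h x ∂ρ - ∫ x, f x * min (h x) M ∂ρ| ≤ ‖f‖ * (δ * C) := by
  have hh : Integrable h ρ :=
    Integrable.mono' ((integrable_const M).add (hGi.const_mul δ)) hc.aestronglyMeasurable
      (.of_forall fun x => by simpa [abs_of_nonneg (h0 x)] using hdom x)
  have hm : Integrable (fun x => min (h x) M) ρ := hh.inf (integrable_const M)
  have hfb : ∀ᵐ x ∂ρ, ‖f x‖ ≤ ‖f‖ := .of_forall f.norm_coe_le_norm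
  have hfm : AEStronglyMeasurable f ρ := f.continuous.aestronglyMeasurable
  rw [← integral_sub (hh.bdd_mul hfm hfb) (hm.bdd_mul hfm hfb)]
  calc |∫ x, f x * h x - f x * min (h x) M ∂ρ|
      ≤ ∫ x, ‖f‖ * (δ * G x) ∂ρ := by
        rw [← Real.norm_eq_abs]
        refine norm_integral_le_of_norm_le (G := ℝ) ((hGi.const_mul δ).const_mul _)
          (.of_forall fun x => ?_)
        rw [← mul_sub, norm_mul]
        refine mul_le_mul (f.norm_coe_le_norm x) ?_ (norm_nonneg _) (norm_nonneg _)
        rw [Real.norm_eq_abs, abs_of_nonneg (sub_nonneg.2 (min_le_left _ _))]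
        rcases le_total (h x) M with h1 | h1
        · rw [min_eq_left h1, sub_self]; exact mul_nonneg hδ (G0 x)
        · rw [min_eq_right h1]; linarith [hdom x]
    _ ≤ ‖f‖ * (δ * C) := by
        rw [integral_const_mul, integral_const_mul]
        gcongr

/-- Weak convergence extends to test functions `f * h`, with `f` bounded continuous and `h`
unbounded, if `h` is negligible at infinity relative to a function with bounded integrals. -/
theorem tendsto_integral_mul_of_dominated {E : Type*} [TopologicalSpace E]
    [MeasurableSpace E] [OpensMeasurableSpace E] {μ : ℕ → ProbabilityMeasure E}
    {ν : ProbabilityMeasure E} (hμ : Tendsto μ atTop (𝓝 ν)) (f : BoundedContinuousFunction E ℝ)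
    {h G : E → ℝ} (hc : Continuous h) (h0 : ∀ x, 0 ≤ h x) (G0 : ∀ x, 0 ≤ G x)
    (hdom : ∀ δ > 0, ∃ M, 0 ≤ M ∧ ∀ x, h x ≤ M + δ * G x) {C : ℝ}
    (hGi : ∀ᶠ k in atTop, Integrable G (μ k : Measure E))
    (hG : ∀ᶠ k in atTop, ∫ x, G x ∂(μ k : Measure E) ≤ C) (hν : Integrable G (ν : Measure E)) :
    Tendsto (fun k => ∫ x, f x * h x ∂(μ k : Measure E)) atTop
      (𝓝 (∫ x, f x * h x ∂(ν : Measure E))) := by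
  rw [Metric.tendsto_nhds]
  intro ε hε
  -- One constant bounds the integrals of `G` along the sequence and in the limit, so both
  -- truncation errors are below `ε / 3`.
  set K := max C (∫ x, G x ∂(ν : Measure E)) with hK
  have hK0 : 0 ≤ K := (integral_nonneg G0).trans (le_max_right _ _)
  obtain ⟨δ, hδ, hδε⟩ : ∃ δ > 0, ‖f‖ * (δ * K) < ε / 3 := by
    refine ⟨ε / 3 / (‖f‖ * K + 1), by positivity, ?_⟩
    have h1 : 0 < ‖f‖ * K + 1 := by positivity
    rw [show ‖f‖ * (ε / 3 / (‖f‖ * K + 1) * K) = ε / 3 * (‖f‖ * K) / (‖f‖ * K + 1) by ring,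
      div_lt_iff₀ h1]
    nlinarith
  obtain ⟨M, hM, hMd⟩ := hdom δ hδ
  let g : BoundedContinuousFunction E ℝ := BoundedContinuousFunction.ofNormedAddCommGroup
    (fun x => min (h x) M) (by fun_prop) M fun x => by
      rw [Real.norm_eq_abs, abs_of_nonneg (le_min (h0 x) hM)]
      exact min_le_right _ _
  have hlim := (ProbabilityMeasure.tendsto_iff_forall_integral_tendsto.1 hμ) (f * g)
  have hev := (Metric.tendsto_nhds.1 hlim) (ε / 3) (by positivity)
  filter_upwards [hGi, hG, hev] with k h1 h2 h3
  have e1 := abs_integral_mul_sub_integral_mul_min_le (μ k : Measure E) f hc h0 G0 hδ.le hMd h1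
    (h2.trans (le_max_left _ _) : _ ≤ K)
  have e2 := abs_integral_mul_sub_integral_mul_min_le (ν : Measure E) f hc h0 G0 hδ.le hMd hν
    (le_max_right _ _ : _ ≤ K)
  rw [Real.dist_eq] at h3 ⊢
  change |∫ x, f x * min (h x) M ∂(μ k : Measure E) - ∫ x, f x * min (h x) M ∂(ν : Measure E)|
    < ε / 3 at h3
  rw [abs_le] at e1 e2
  rw [abs_lt] at h3 ⊢
  constructor <;> linarith

/-! ### Gaussian laws and quadratic tilts in rotated coordinates -/

/-- The linear map `(u, v) ↦ (u + v, u - v)`. -/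
def rotate (z : ℝ × ℝ) : EuclideanSpace ℝ (Fin 2) := !₂[z.1 + z.2, z.1 - z.2]

@[fun_prop]
theorem measurable_rotate : Measurable rotate := by
  unfold rotate
  fun_prop

/-- The law of `(u + v, u - v)` for independent centered Gaussians `u` and `v` of variances `v`
and `w`. -/
def rotatedGaussian (v w : ℝ≥0) : ProbabilityMeasure (EuclideanSpace ℝ (Fin 2)) :=
  ⟨((gaussianReal 0 v).prod (gaussianReal 0 w)).map rotate,
    Measure.isProbabilityMeasure_map (by fun_prop)⟩

theorem charFun_rotatedGaussian (v w : ℝ≥0) (s : EuclideanSpace ℝ (Fin 2)) :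
    charFun (rotatedGaussian v w : Measure (EuclideanSpace ℝ (Fin 2))) s =
      Real.exp (-(v * (s 0 + s 1) ^ 2 + w * (s 0 - s 1) ^ 2) / 2) := by
  have h1 : ∀ z : ℝ × ℝ, Complex.exp (↑(inner ℝ (rotate z) s) * Complex.I) =
      Complex.exp (↑(s 0 + s 1) * z.1 * Complex.I) * Complex.exp (↑(s 0 - s 1) * z.2 * Complex.I) := by
    intro z
    rw [← Complex.exp_add]
    congr 1
    simp [rotate, PiLp.inner_apply, Fin.sum_univ_two]
    ring
  rw [charFun_apply]
  simp only [rotatedGaussian, ProbabilityMeasure.coe_mk]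
  rw [integral_map (by fun_prop) (by fun_prop)]
  simp_rw [h1]
  rw [integral_prod_mul (fun u : ℝ => Complex.exp (↑(s 0 + s 1) * u * Complex.I))
    (fun u : ℝ => Complex.exp (↑(s 0 - s 1) * u * Complex.I))]
  have h2 := charFun_gaussianReal (μ := 0) (v := v) (s 0 + s 1)
  have h3 := charFun_gaussianReal (μ := 0) (v := w) (s 0 - s 1)
  rw [charFun_apply_real] at h2 h3
  rw [h2, h3, ← Complex.exp_add]
  push_cast
  congr 1
  ring

theorem limitCov_posSemidef {β a : ℝ} (hβ : 0 < β) (ha0 : 0 ≤ a) (h : β * (1 + a) < 2) :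
    (limitCov β a).PosSemidef := by
  have h1 : 0 < 2 - β - β * a := by linarith
  have h2 : 0 < 2 - β + β * a := by nlinarith [mul_nonneg hβ.le ha0]
  have h3 : 0 < 2 - β := by nlinarith [mul_nonneg hβ.le ha0]
  have hD : 0 < (1 - β) + β ^ 2 * (1 - a ^ 2) / 4 := by nlinarith [mul_pos h1 h2]
  refine Matrix.PosSemidef.smul ?_ (div_pos h3 hD).le
  refine Matrix.PosSemidef.of_dotProduct_mulVec_nonneg ?_ fun x => ?_
  · ext i j
    fin_cases i <;> fin_cases j <;> simp
  · simp [Matrix.mulVec, dotProduct, Fin.sum_univ_two]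
    have hc : 0 ≤ β * a / (2 - β) := by positivity
    have hc1 : β * a / (2 - β) ≤ 1 := by rw [div_le_one h3]; linarith
    -- With `q = β a / (2 - β) ∈ [0, 1]`, the form is `q (x₀ + x₁)² + (1 - q) (x₀² + x₁²)`.
    nlinarith [mul_nonneg hc (sq_nonneg (x 0 + x 1)),
      mul_nonneg (sub_nonneg.2 hc1) (add_nonneg (sq_nonneg (x 0)) (sq_nonneg (x 1)))]

/-- The limiting covariance is diagonal in the basis `(1, 1)`, `(1, -1)`, with eigenvalues `2 v` and
`2 w`; its scalar denominator factors as `(2 - β - β a) (2 - β + β a) / 4`. -/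
theorem rotatedGaussian_eq_centeredGaussian {β a : ℝ} (hβ : 0 < β) (ha0 : 0 ≤ a)
    (h : β * (1 + a) < 2) {v w : ℝ≥0} (hv : (v : ℝ) = 2 / (2 - β - β * a))
    (hw : (w : ℝ) = 2 / (2 - β + β * a)) :
    rotatedGaussian v w = centeredGaussian (limitCov β a) := by
  have hS := limitCov_posSemidef hβ ha0 h
  have h1 : 0 < 2 - β - β * a := by linarith
  have h2 : 0 < 2 - β + β * a := by nlinarith [mul_nonneg hβ.le ha0]
  have h3 : 0 < 2 - β := by nlinarith [mul_nonneg hβ.le ha0]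
  refine Subtype.ext (Measure.ext_of_charFun (μ := (rotatedGaussian v w : Measure _))
    (ν := multivariateGaussian 0 (limitCov β a)) ?_)
  ext s
  rw [charFun_rotatedGaussian]
  rw [charFun_multivariateGaussian hS]
  simp only [limitCov, Complex.ofReal_exp, inner_zero_right, Complex.ofReal_zero, zero_mul,
    zero_sub]
  congr 1
  rw [← Complex.ofReal_ofNat, ← Complex.ofReal_div, ← Complex.ofReal_neg]
  congr 1
  have hD : (1 - β) + β ^ 2 * (1 - a ^ 2) / 4 = (2 - β - β * a) * (2 - β + β * a) / 4 := by ring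
  rw [hD, hv, hw]
  simp [Matrix.mulVec, dotProduct, Fin.sum_univ_two]
  field_simp
  ring

/-- The exponents combine to `-(1 - 2c) u² / 2`, an unnormalized Gaussian density of variance `v`;
`√v` is the ratio of the normalizing constants. -/
theorem gaussianReal_withDensity_exp {c : ℝ} {v : ℝ≥0} (hv : (v : ℝ) = 1 / (1 - 2 * c))
    (hc : 2 * c < 1) :
    (gaussianReal 0 1).withDensity (fun u => ENNReal.ofReal (Real.exp (c * u ^ 2))) =
      ENNReal.ofReal (√v) • gaussianReal 0 v := by
  have h1 : 0 < 1 - 2 * c := by linarith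
  have hv0 : v ≠ 0 := by
    intro h0
    rw [h0, NNReal.coe_zero] at hv
    have : 0 < 1 / (1 - 2 * c) := by positivity
    linarith
  rw [gaussianReal_of_var_ne_zero _ one_ne_zero, gaussianReal_of_var_ne_zero _ hv0,
    ← withDensity_mul _ (measurable_gaussianPDF _ _) (by fun_prop),
    ← withDensity_smul _ (measurable_gaussianPDF _ _)]
  congr 1
  ext u
  simp only [Pi.mul_apply, Pi.smul_apply, smul_eq_mul, gaussianPDF]
  rw [← ENNReal.ofReal_mul (gaussianPDFReal_nonneg _ _ _), ← ENNReal.ofReal_mul (by positivity)]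
  congr 1
  simp only [gaussianPDFReal, sub_zero, NNReal.coe_one, mul_one]
  have hvp : (0 : ℝ) < v := by positivity
  rw [Real.sqrt_mul (by positivity) (v : ℝ), mul_inv, mul_assoc, ← Real.exp_add]
  have : √(v : ℝ) ≠ 0 := by positivity
  rw [show √(v : ℝ) * ((√(2 * Real.pi))⁻¹ * (√(v : ℝ))⁻¹ * Real.exp (-u ^ 2 / (2 * v))) =
    (√(2 * Real.pi))⁻¹ * Real.exp (-u ^ 2 / (2 * v)) by field_simp]
  congr 2
  rw [hv]
  field_simp
  ring

/-- The quadratic form which is `c u² + d v²` in the coordinates of `rotate`. -/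
def quadForm (c d : ℝ) (x : EuclideanSpace ℝ (Fin 2)) : ℝ :=
  c * ((x 0 + x 1) / 2) ^ 2 + d * ((x 0 - x 1) / 2) ^ 2

@[fun_prop]
theorem continuous_quadForm (c d : ℝ) : Continuous (quadForm c d) := by
  unfold quadForm
  fun_prop

theorem quadForm_rotate (c d : ℝ) (z : ℝ × ℝ) :
    quadForm c d (rotate z) = c * z.1 ^ 2 + d * z.2 ^ 2 := by
  simp [quadForm, rotate]

theorem rotatedGaussian_withDensity_exp {c d : ℝ} {v w : ℝ≥0} (hv : (v : ℝ) = 1 / (1 - 2 * c))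
    (hc : 2 * c < 1) (hw : (w : ℝ) = 1 / (1 - 2 * d)) (hd : 2 * d < 1) :
    (rotatedGaussian 1 1 : Measure (EuclideanSpace ℝ (Fin 2))).withDensity
      (fun x => ENNReal.ofReal (Real.exp (quadForm c d x))) =
      ENNReal.ofReal (√v * √w) •
        (rotatedGaussian v w : Measure (EuclideanSpace ℝ (Fin 2))) := by
  simp only [rotatedGaussian, ProbabilityMeasure.coe_mk]
  have hm : Measurable fun x => ENNReal.ofReal (Real.exp (quadForm c d x)) :=
    ((continuous_quadForm c d).rexp.measurable).ennreal_ofReal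
  have h1 : ((gaussianReal 0 1).prod (gaussianReal 0 1)).withDensity
      ((fun x => ENNReal.ofReal (Real.exp (quadForm c d x))) ∘ rotate) =
      ENNReal.ofReal (√v * √w) • (gaussianReal 0 v).prod (gaussianReal 0 w) := by
    have : ((fun x => ENNReal.ofReal (Real.exp (quadForm c d x))) ∘ rotate) =
        fun z : ℝ × ℝ => ENNReal.ofReal (Real.exp (c * z.1 ^ 2)) *
          ENNReal.ofReal (Real.exp (d * z.2 ^ 2)) := by
      ext z
      simp only [Function.comp_apply]
      rw [quadForm_rotate, Real.exp_add, ENNReal.ofReal_mul (by positivity)]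
    have hv1 := gaussianReal_withDensity_exp hv hc
    have hw1 := gaussianReal_withDensity_exp hw hd
    rw [this, ← prod_withDensity (f := fun u : ℝ => ENNReal.ofReal (Real.exp (c * u ^ 2)))
      (g := fun u : ℝ => ENNReal.ofReal (Real.exp (d * u ^ 2))) (by fun_prop) (by fun_prop), hv1, hw1, Measure.prod_smul_left,
      Measure.prod_smul_right, smul_smul, ENNReal.ofReal_mul (by positivity)]
  rw [← Measure.map_smul, ← h1]
  ext s hs
  rw [withDensity_apply _ hs, Measure.map_apply measurable_rotate hs,
    withDensity_apply _ (measurable_rotate hs), setLIntegral_map hs hm measurable_rotate]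
  rfl

theorem integral_rotatedGaussian_mul_exp {c d : ℝ} {v w : ℝ≥0} (hv : (v : ℝ) = 1 / (1 - 2 * c))
    (hc : 2 * c < 1) (hw : (w : ℝ) = 1 / (1 - 2 * d)) (hd : 2 * d < 1)
    (f : EuclideanSpace ℝ (Fin 2) → ℝ) :
    ∫ x, f x * Real.exp (quadForm c d x)
      ∂(rotatedGaussian 1 1 : Measure (EuclideanSpace ℝ (Fin 2))) =
      √v * √w * ∫ x, f x ∂(rotatedGaussian v w : Measure (EuclideanSpace ℝ (Fin 2))) := by
  have h := integral_withDensity_eq_integral_toReal_smul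
    (μ := (rotatedGaussian 1 1 : Measure (EuclideanSpace ℝ (Fin 2))))
    (f := fun x => ENNReal.ofReal (Real.exp (quadForm c d x)))
    ((continuous_quadForm c d).rexp.measurable.ennreal_ofReal) (.of_forall fun x => by simp) f
  rw [rotatedGaussian_withDensity_exp hv hc hw hd, integral_smul_measure,
    ENNReal.toReal_ofReal (by positivity), smul_eq_mul] at h
  rw [h]
  refine integral_congr_ae (.of_forall fun x => ?_)
  simp only [smul_eq_mul]
  rw [ENNReal.toReal_ofReal (by positivity), mul_comm]

theorem integrable_exp_quadForm_rotatedGaussian {c d : ℝ} (hc : 2 * c < 1) (hd : 2 * d < 1) :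
    Integrable (fun x => Real.exp (quadForm c d x))
      (rotatedGaussian 1 1 : Measure (EuclideanSpace ℝ (Fin 2))) := by
  have h1 : 0 ≤ 1 / (1 - 2 * c) := one_div_nonneg.2 (by linarith)
  have h2 : 0 ≤ 1 / (1 - 2 * d) := one_div_nonneg.2 (by linarith)
  have h := rotatedGaussian_withDensity_exp (v := ⟨_, h1⟩) (w := ⟨_, h2⟩) rfl hc rfl hd
  refine ⟨(continuous_quadForm c d).rexp.aestronglyMeasurable, ?_⟩
  rw [hasFiniteIntegral_iff_ofReal (.of_forall fun x => (Real.exp_pos _).le),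
    ← setLIntegral_univ, ← withDensity_apply _ MeasurableSet.univ, h, Measure.smul_apply,
    smul_eq_mul]
  exact ENNReal.mul_lt_top ENNReal.ofReal_lt_top (measure_lt_top _ _)

/-! ### Independent spins: generating function and central limit theorem -/

/-- Total spin of the first community. -/
def totalSpin₁ {n : ℕ} (σ : Config n) : ℝ := ∑ i ∈ community₁ n, spin σ i

/-- Total spin of the second community. -/
def totalSpin₂ {n : ℕ} (σ : Config n) : ℝ := ∑ i ∈ community₂ n, spin σ i

/-- The magnetization vector, scaled by `√n`. -/
def scaledMagnetization (n : ℕ) (σ : Config n) : EuclideanSpace ℝ (Fin 2) :=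
  Real.sqrt n • magnetization n σ

theorem scaledMagnetization_apply_zero (n : ℕ) (σ : Config n) :
    scaledMagnetization n σ 0 = √n * (1 / (n / 2)) * totalSpin₁ σ := by
  simp [scaledMagnetization, magnetization, totalSpin₁, mul_assoc]

theorem scaledMagnetization_apply_one (n : ℕ) (σ : Config n) :
    scaledMagnetization n σ 1 = √n * (1 / (n / 2)) * totalSpin₂ σ := by
  simp [scaledMagnetization, magnetization, totalSpin₂, mul_assoc]

theorem spin_eq_one_or {n : ℕ} (σ : Config n) (i : Fin n) : spin σ i = 1 ∨ spin σ i = -1 := by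
  rcases Int.units_eq_one_or (σ i) with h | h <;> simp [spin, h]

theorem spin_sq {n : ℕ} (σ : Config n) (i : Fin n) : spin σ i ^ 2 = 1 := by
  rcases spin_eq_one_or σ i with h | h <;> simp [h]

theorem community₂_eq (n : ℕ) :
    community₂ n = Finset.univ.filter fun i : Fin n => ¬ i.val < n / 2 := by
  simp [community₂]

theorem card_community₁ (k : ℕ) : (community₁ (2 * k)).card = k := by
  have : 2 * k / 2 = k := by omega
  rw [community₁, this, Fin.card_filter_val_lt]
  omega

theorem card_community₂ (k : ℕ) : (community₂ (2 * k)).card = k := by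
  have h := Finset.card_filter_add_card_filter_not (s := (Finset.univ : Finset (Fin (2 * k))))
    (fun i => i.val < 2 * k / 2)
  have h1 := card_community₁ k
  rw [community₁] at h1
  rw [community₂_eq]
  rw [h1, Finset.card_univ, Fintype.card_fin] at h
  omega

/-- The sum factorizes over the sites. Complex arguments let one formula give both the
characteristic function and the exponential moments. -/
theorem sum_cexp_totalSpin (k : ℕ) (z w : ℂ) :
    ∑ σ : Config (2 * k), Complex.exp (z * totalSpin₁ σ + w * totalSpin₂ σ) =
      2 ^ (2 * k) * (Complex.cosh z ^ k * Complex.cosh w ^ k) := by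
  have h1 : ∀ σ : Config (2 * k), Complex.exp (z * totalSpin₁ σ + w * totalSpin₂ σ) =
      ∏ i, Complex.exp ((if i.val < 2 * k / 2 then z else w) * ((σ i : ℤ) : ℂ)) := by
    intro σ
    rw [← Complex.exp_sum]
    congr 1
    simp_rw [ite_mul]
    rw [Finset.sum_ite, totalSpin₁, totalSpin₂, community₂_eq, community₁]
    simp [Finset.mul_sum, spin]
  simp_rw [h1]
  have h2 := Finset.prod_univ_sum (fun _ : Fin (2 * k) => (Finset.univ : Finset ℤˣ))
    (fun i u => Complex.exp ((if i.val < 2 * k / 2 then z else w) * ((u : ℤ) : ℂ)))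
  rw [Fintype.piFinset_univ] at h2
  rw [← h2]
  have h3 : ∀ i : Fin (2 * k), ∑ u : ℤˣ,
      Complex.exp ((if i.val < 2 * k / 2 then z else w) * ((u : ℤ) : ℂ)) =
      if i.val < 2 * k / 2 then 2 * Complex.cosh z else 2 * Complex.cosh w := by
    intro i
    rw [UnitsInt.univ, Finset.sum_pair (by decide)]
    split_ifs <;> simp [Complex.cosh] <;> ring
  simp_rw [h3]
  rw [Finset.prod_ite, Finset.prod_const, Finset.prod_const]
  have h4 := card_community₁ k
  have h5 := card_community₂ k
  rw [community₂_eq] at h5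
  rw [community₁] at h4
  rw [h4, h5, mul_pow, mul_pow]
  ring

theorem sum_exp_totalSpin (k : ℕ) (z w : ℝ) :
    ∑ σ : Config (2 * k), Real.exp (z * totalSpin₁ σ + w * totalSpin₂ σ) =
      2 ^ (2 * k) * (Real.cosh z ^ k * Real.cosh w ^ k) := by
  have h := sum_cexp_totalSpin k z w
  exact_mod_cast h

theorem integral_scaledMagnetizationLaw {F : Type*} [NormedAddCommGroup F] [NormedSpace ℝ F]
    [CompleteSpace F] (n : ℕ) (p β : ℝ) (x : internalEdges n → ℝ) (z : externalEdges n → ℝ)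
    {f : EuclideanSpace ℝ (Fin 2) → F} (hf : Continuous f) :
    ∫ y, f y ∂(scaledMagnetizationLaw n p β x z : Measure (EuclideanSpace ℝ (Fin 2))) =
      ∑ σ, gibbsWeight n p β x z σ • f (scaledMagnetization n σ) := by
  have h0 : ∀ σ, 0 ≤ gibbsWeight n p β x z σ := fun σ =>
    div_nonneg (Real.exp_pos _).le (partitionFunction_pos n p β x z).le
  rw [scaledMagnetizationLaw, ProbabilityMeasure.toMeasure_map,
    integral_map (measurable_of_finite _).aemeasurable
      (hf.stronglyMeasurable.aestronglyMeasurable), gibbs, ProbabilityMeasure.coe_mk,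
    integral_finsetSum_measure fun σ _ => ?_]
  · refine Finset.sum_congr rfl fun σ _ => ?_
    rw [integral_smul_measure, integral_dirac, ENNReal.toReal_ofReal (h0 σ), scaledMagnetization]
  · exact Integrable.of_finite.smul_measure ENNReal.ofReal_ne_top

/-- The law of the scaled magnetization of independent unbiased spins. -/
def uniformLaw (n : ℕ) : ProbabilityMeasure (EuclideanSpace ℝ (Fin 2)) :=
  -- At `β = 0` every configuration has the same weight; the other arguments are placeholders.
  scaledMagnetizationLaw n 1 0 0 0

theorem integral_uniformLaw {F : Type*} [NormedAddCommGroup F] [NormedSpace ℝ F]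
    [CompleteSpace F] (n : ℕ) {f : EuclideanSpace ℝ (Fin 2) → F} (hf : Continuous f) :
    ∫ y, f y ∂(uniformLaw n : Measure (EuclideanSpace ℝ (Fin 2))) =
      ((2 : ℝ) ^ n)⁻¹ • ∑ σ, f (scaledMagnetization n σ) := by
  rw [uniformLaw, integral_scaledMagnetizationLaw n _ _ _ _ hf, Finset.smul_sum]
  simp [gibbsWeight, partitionFunction]

/-- Here `f x = x * dslope f 0 x`, and the slope tends to `1`. It serves for `sin`, `tanh` and
`artanh`, all equivalent to the identity at `0`. -/
theorem tendsto_mul_of_hasDerivAt {f : ℝ → ℝ} (hf : HasDerivAt f 1 0) (h0 : f 0 = 0) {u x : ℕ → ℝ}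
    {L : ℝ} (hu : Tendsto u atTop atTop) (hx : Tendsto (fun k => u k * x k) atTop (𝓝 L)) :
    Tendsto (fun k => u k * f (x k)) atTop (𝓝 L) := by
  have hx0 : Tendsto x atTop (𝓝 0) := by
    have h := hx.mul hu.inv_tendsto_atTop
    rw [mul_zero] at h
    refine h.congr' ?_
    filter_upwards [hu.eventually_gt_atTop 0] with k hk
    simp only [Pi.inv_apply]
    field_simp
  have hc : ContinuousAt (dslope f 0) 0 := continuousAt_dslope_same.2 hf.differentiableAt
  have h1 : Tendsto (fun k => dslope f 0 (x k)) atTop (𝓝 1) := by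
    have := hc.tendsto.comp hx0
    rwa [dslope_same, hf.deriv] at this
  have h2 := hx.mul h1
  rw [mul_one] at h2
  refine h2.congr fun k => ?_
  have h3 := sub_smul_dslope f 0 (x k)
  rw [sub_zero, h0, sub_zero, smul_eq_mul] at h3
  rw [mul_assoc, h3]

theorem tendsto_cos_pow (s : ℝ) :
    Tendsto (fun k : ℕ => Real.cos (2 * s / √(2 * k : ℕ)) ^ k) atTop (𝓝 (Real.exp (-s ^ 2))) := by
  have hu : Tendsto (fun k : ℕ => √(2 * k : ℕ)) atTop atTop := by
    refine Real.tendsto_sqrt_atTop.comp (tendsto_natCast_atTop_atTop.comp ?_)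
    exact tendsto_id.const_mul_atTop' (by norm_num)
  have hs : Tendsto (fun k : ℕ => √(2 * k : ℕ) * Real.sin (s / √(2 * k : ℕ))) atTop (𝓝 s) := by
    refine tendsto_mul_of_hasDerivAt (by simpa using Real.hasDerivAt_sin 0) Real.sin_zero hu ?_
    refine tendsto_const_nhds.congr' ?_
    filter_upwards [hu.eventually_gt_atTop 0] with k hk
    field_simp
  have h := Real.tendsto_one_add_pow_exp_of_tendsto
    (g := fun k : ℕ => Real.cos (2 * s / √(2 * k : ℕ)) - 1) (t := -s ^ 2) ?_
  · simpa using h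
  -- `cos (2x) - 1 = -2 sin² x`, so `k` times the increment is exactly `-(√(2k) sin (s / √(2k)))²`.
  · refine ((hs.pow 2).neg).congr fun k => ?_
    rw [mul_div_assoc, Real.cos_two_mul, Real.cos_sq', mul_pow, Real.sq_sqrt (by positivity)]
    push_cast
    ring

theorem sqrt_mul_one_div_half {n : ℕ} (hn : 0 < n) : √(n : ℝ) * (1 / (n / 2)) = 2 / √n := by
  have : (0 : ℝ) < n := by exact_mod_cast hn
  have h := Real.mul_self_sqrt this.le
  have h2 : 0 < √(n : ℝ) := Real.sqrt_pos.2 this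
  field_simp
  nlinarith

theorem tendsto_uniformLaw :
    Tendsto (fun k : ℕ => uniformLaw (2 * k)) atTop (𝓝 (rotatedGaussian 1 1)) := by
  rw [ProbabilityMeasure.tendsto_iff_tendsto_charFun]
  intro s
  rw [charFun_rotatedGaussian]
  have h := (tendsto_cos_pow (s 0)).mul (tendsto_cos_pow (s 1))
  rw [← Real.exp_add] at h
  have h' := (Complex.continuous_ofReal.tendsto _).comp h
  convert h'.congr' ?_ using 2
  · congr 2
    simp
    ring
  · filter_upwards [eventually_gt_atTop 0] with k hk
    rw [charFun_apply, integral_uniformLaw _ (by fun_prop)]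
    have h1 : ∀ σ : Config (2 * k),
        Complex.exp (↑(inner ℝ (scaledMagnetization (2 * k) σ) s) * Complex.I) =
        Complex.exp (↑(2 * s 0 / √(2 * k : ℕ)) * Complex.I * totalSpin₁ σ +
          ↑(2 * s 1 / √(2 * k : ℕ)) * Complex.I * totalSpin₂ σ) := by
      intro σ
      congr 1
      simp only [PiLp.inner_apply, Fin.sum_univ_two, scaledMagnetization_apply_zero,
        scaledMagnetization_apply_one, sqrt_mul_one_div_half (show 0 < 2 * k by omega)]
      simp
      ring
    simp_rw [h1]
    rw [sum_cexp_totalSpin, Complex.cosh_mul_I, Complex.cosh_mul_I]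
    simp

/-! ### Uniform exponential moments and the tilted limit -/

theorem integrable_exp_mul_sq_gaussianReal {c : ℝ} (hc : 2 * c < 1) :
    Integrable (fun u => Real.exp (c * u ^ 2)) (gaussianReal 0 1) := by
  have h1 : 0 ≤ 1 / (1 - 2 * c) := one_div_nonneg.2 (by linarith)
  obtain ⟨v, hv⟩ : ∃ v : ℝ≥0, (v : ℝ) = 1 / (1 - 2 * c) := ⟨⟨_, h1⟩, rfl⟩
  have h := gaussianReal_withDensity_exp hv hc
  refine ⟨by fun_prop, ?_⟩
  rw [hasFiniteIntegral_iff_ofReal (.of_forall fun x => (Real.exp_pos _).le),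
    ← setLIntegral_univ, ← withDensity_apply _ MeasurableSet.univ, h, Measure.smul_apply,
    smul_eq_mul]
  exact ENNReal.mul_lt_top ENNReal.ofReal_lt_top (measure_lt_top _ _)

theorem quadForm_scaledMagnetization {k : ℕ} (hk : 0 < k) (c d : ℝ) (σ : Config (2 * k)) :
    quadForm c d (scaledMagnetization (2 * k) σ) =
      (c * (totalSpin₁ σ + totalSpin₂ σ) ^ 2 + d * (totalSpin₁ σ - totalSpin₂ σ) ^ 2) /
        (2 * k) := by
  have hk' : (0 : ℝ) < k := by exact_mod_cast hk
  have h := Real.sq_sqrt (show (0 : ℝ) ≤ (2 * k : ℕ) by positivity)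
  simp only [quadForm, scaledMagnetization_apply_zero, scaledMagnetization_apply_one,
    sqrt_mul_one_div_half (show 0 < 2 * k by omega)]
  rw [← mul_add, ← mul_sub, mul_div_right_comm, mul_div_right_comm, mul_pow, mul_pow, div_pow,
    div_pow, h]
  push_cast
  field_simp

/-- The Hubbard-Stratonovich bound for the exponential moments of the total spins. -/
theorem exists_integral_exp_quadForm_uniformLaw_le {c : ℝ} (hc0 : 0 ≤ c) (hc : 2 * c < 1) :
    ∃ K, ∀ k : ℕ, 0 < k → ∫ y, Real.exp (quadForm c c y)
      ∂(uniformLaw (2 * k) : Measure (EuclideanSpace ℝ (Fin 2))) ≤ K := by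
  set γ := gaussianReal 0 1
  refine ⟨∫ z : ℝ × ℝ, Real.exp (c * z.1 ^ 2) * Real.exp (c * z.2 ^ 2) ∂(γ.prod γ), fun k hk => ?_⟩
  have hk' : (0 : ℝ) < k := by exact_mod_cast hk
  rw [integral_uniformLaw _ (by fun_prop)]
  -- Chosen so that `exp (c S² / k)` is the Gaussian average of `exp (θ S z)`, which linearizes the
  -- square in the total spin.
  set θ := √(2 * c / k)
  have hθ : θ ^ 2 = 2 * c / k := Real.sq_sqrt (by positivity)
  have hmgf : ∀ S : ℝ, ∫ z, Real.exp ((θ * S) * z) ∂γ = Real.exp (c * S ^ 2 / k) := by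
    intro S
    have h := congr_fun (mgf_fun_id_gaussianReal (μ := 0) (v := 1)) (θ * S)
    simp only [mgf] at h
    rw [h, mul_pow, hθ]
    congr 1
    simp
    field_simp
  have hint : ∀ σ : Config (2 * k), Integrable (fun z : ℝ × ℝ =>
      Real.exp ((θ * totalSpin₁ σ) * z.1) * Real.exp ((θ * totalSpin₂ σ) * z.2)) (γ.prod γ) :=
    fun σ => (integrable_exp_mul_gaussianReal _).mul_prod (integrable_exp_mul_gaussianReal _)
  have h1 : ∀ σ : Config (2 * k), Real.exp (quadForm c c (scaledMagnetization (2 * k) σ)) =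
      ∫ z : ℝ × ℝ, Real.exp ((θ * totalSpin₁ σ) * z.1) * Real.exp ((θ * totalSpin₂ σ) * z.2)
        ∂(γ.prod γ) := by
    intro σ
    rw [integral_prod_mul (fun z => Real.exp ((θ * totalSpin₁ σ) * z))
      (fun z => Real.exp ((θ * totalSpin₂ σ) * z)), hmgf, hmgf, ← Real.exp_add,
      quadForm_scaledMagnetization hk]
    congr 1
    field_simp
    ring
  simp_rw [h1]
  rw [← integral_finsetSum _ fun σ _ => hint σ, smul_eq_mul, ← integral_const_mul]
  refine integral_mono ((integrable_finsetSum _ fun σ _ => hint σ).const_mul _)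
    ((integrable_exp_mul_sq_gaussianReal hc).mul_prod (integrable_exp_mul_sq_gaussianReal hc))
    fun z => ?_
  have h2 : ∀ σ : Config (2 * k), Real.exp ((θ * totalSpin₁ σ) * z.1) *
      Real.exp ((θ * totalSpin₂ σ) * z.2) =
      Real.exp (θ * z.1 * totalSpin₁ σ + θ * z.2 * totalSpin₂ σ) := by
    intro σ
    rw [← Real.exp_add]
    congr 1
    ring
  simp_rw [h2]
  rw [sum_exp_totalSpin, inv_mul_cancel_left₀ (by positivity)]
  -- Since `k θ² / 2 = c`, the power `k` cancels and the bound no longer depends on `k`.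
  have h3 : ∀ u : ℝ, Real.cosh (θ * u) ^ k ≤ Real.exp (c * u ^ 2) := by
    intro u
    calc Real.cosh (θ * u) ^ k ≤ Real.exp ((θ * u) ^ 2 / 2) ^ k :=
          pow_le_pow_left₀ (Real.cosh_pos _).le (Real.cosh_le_exp_half_sq _) _
      _ = Real.exp (c * u ^ 2) := by
          rw [← Real.exp_nat_mul, mul_pow, hθ]
          congr 1
          field_simp
  exact mul_le_mul (h3 _) (h3 _) (pow_nonneg (Real.cosh_pos _).le _) (Real.exp_pos _).le

theorem quadForm_self (c : ℝ) (y : EuclideanSpace ℝ (Fin 2)) :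
    quadForm c c y = c * quadForm 1 1 y := by
  simp only [quadForm]
  ring

theorem quadForm_one_nonneg (y : EuclideanSpace ℝ (Fin 2)) : 0 ≤ quadForm 1 1 y := by
  simp only [quadForm, one_mul]
  positivity

theorem quadForm_le {c d b : ℝ} (hc : c ≤ b) (hd : d ≤ b) (y : EuclideanSpace ℝ (Fin 2)) :
    quadForm c d y ≤ b * quadForm 1 1 y := by
  rw [← quadForm_self, quadForm, quadForm]
  gcongr

theorem quadForm_nonneg {c d : ℝ} (hc : 0 ≤ c) (hd : 0 ≤ d) (y : EuclideanSpace ℝ (Fin 2)) :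
    0 ≤ quadForm c d y := by
  rw [quadForm]
  positivity

theorem abs_quadForm_sub_le (c d c' d' : ℝ) (y : EuclideanSpace ℝ (Fin 2)) :
    |quadForm c d y - quadForm c' d' y| ≤ (|c - c'| + |d - d'|) * quadForm 1 1 y := by
  have h : quadForm c d y - quadForm c' d' y =
      (c - c') * ((y 0 + y 1) / 2) ^ 2 + (d - d') * ((y 0 - y 1) / 2) ^ 2 := by
    simp only [quadForm]
    ring
  rw [h]
  refine (abs_add_le _ _).trans ?_
  rw [abs_mul, abs_mul, abs_sq, abs_sq]
  simp only [quadForm]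
  nlinarith [mul_nonneg (abs_nonneg (c - c')) (sq_nonneg ((y 0 - y 1) / 2)),
    mul_nonneg (abs_nonneg (d - d')) (sq_nonneg ((y 0 + y 1) / 2))]

theorem abs_exp_sub_exp_le {x y z : ℝ} (hx : x ≤ z) (hy : y ≤ z) :
    |Real.exp x - Real.exp y| ≤ |x - y| * Real.exp z := by
  wlog h : y ≤ x generalizing x y
  · rw [abs_sub_comm, abs_sub_comm x]
    exact this hy hx (le_of_not_ge h)
  rw [abs_of_nonneg (sub_nonneg.2 (Real.exp_le_exp.2 h)), abs_of_nonneg (sub_nonneg.2 h)]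
  have h1 := Real.add_one_le_exp (y - x)
  have h2 : Real.exp y = Real.exp x * Real.exp (y - x) := by rw [← Real.exp_add]; ring_nf
  calc Real.exp x - Real.exp y ≤ (x - y) * Real.exp x := by
        rw [h2]; nlinarith [Real.exp_pos x]
    _ ≤ (x - y) * Real.exp z :=
        mul_le_mul_of_nonneg_left (Real.exp_le_exp.2 hx) (sub_nonneg.2 h)

theorem mul_exp_le {b b' N : ℝ} (hb : b < b') :
    N * Real.exp (b * N) ≤ (b' - b)⁻¹ * Real.exp (b' * N) := by
  have h : 0 < b' - b := sub_pos.2 hb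
  have h1 := Real.add_one_le_exp ((b' - b) * N)
  have h2 : Real.exp (b' * N) = Real.exp ((b' - b) * N) * Real.exp (b * N) := by
    rw [← Real.exp_add]; ring_nf
  rw [h2, ← mul_assoc]
  refine mul_le_mul_of_nonneg_right ?_ (Real.exp_pos _).le
  rw [inv_mul_eq_div, le_div_iff₀ h]
  linarith

theorem integrable_uniformLaw (n : ℕ) {f : EuclideanSpace ℝ (Fin 2) → ℝ} (hf : Continuous f) :
    Integrable f (uniformLaw n : Measure (EuclideanSpace ℝ (Fin 2))) := by
  rw [uniformLaw, scaledMagnetizationLaw, ProbabilityMeasure.toMeasure_map,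
    integrable_map_measure hf.aestronglyMeasurable (measurable_of_finite _).aemeasurable]
  exact Integrable.of_finite

/-- There is room for `c < b < b' < 1 / 2`. The bounded moment at `b'` gives uniform integrability
for the fixed tilt. Eventually `cs k` and `ds k` lie below `b`, and replacing them by their limits
costs their distance times the same moment. -/
theorem tendsto_integral_uniformLaw_mul_exp {c d : ℝ} (hc0 : 0 ≤ c) (hdc : d ≤ c) (hc : 2 * c < 1)
    {cs ds : ℕ → ℝ} (hcs : Tendsto cs atTop (𝓝 c)) (hds : Tendsto ds atTop (𝓝 d))
    (f : BoundedContinuousFunction (EuclideanSpace ℝ (Fin 2)) ℝ) :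
    Tendsto (fun k => ∫ y, f y * Real.exp (quadForm (cs k) (ds k) y)
        ∂(uniformLaw (2 * k) : Measure (EuclideanSpace ℝ (Fin 2)))) atTop
      (𝓝 (∫ y, f y * Real.exp (quadForm c d y)
        ∂(rotatedGaussian 1 1 : Measure (EuclideanSpace ℝ (Fin 2))))) := by
  obtain ⟨b', hb', hb'1⟩ : ∃ b', c < b' ∧ b' < 1 / 2 := exists_between (by linarith)
  obtain ⟨b, hb, hbb'⟩ := exists_between hb'
  obtain ⟨K, hK⟩ := exists_integral_exp_quadForm_uniformLaw_le (c := b') (by linarith)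
    (by linarith)
  have hlim : Tendsto (fun k => ∫ y, f y * Real.exp (quadForm c d y)
        ∂(uniformLaw (2 * k) : Measure (EuclideanSpace ℝ (Fin 2)))) atTop
      (𝓝 (∫ y, f y * Real.exp (quadForm c d y)
        ∂(rotatedGaussian 1 1 : Measure (EuclideanSpace ℝ (Fin 2))))) := by
    refine tendsto_integral_mul_of_dominated (G := fun y => Real.exp (quadForm b' b' y)) (C := K)
      tendsto_uniformLaw f (by fun_prop) (fun _ => (Real.exp_pos _).le)
      (fun _ => (Real.exp_pos _).le) (fun δ hδ => ?_)
      (.of_forall fun k => integrable_uniformLaw _ (by fun_prop)) ?_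
      (integrable_exp_quadForm_rotatedGaussian (by linarith) (by linarith))
    -- Beyond `N = -log δ / (b' - c)` the term `δ exp (b' N)` dominates `exp (c N)`.
    · refine ⟨Real.exp (c * (-Real.log δ / (b' - c))), (Real.exp_pos _).le, fun y => ?_⟩
      have h1 := Real.exp_le_exp.2 (quadForm_le le_rfl hdc y)
      refine h1.trans ?_
      rw [quadForm_self b']
      set N := quadForm 1 1 y
      have hbc : 0 < b' - c := sub_pos.2 hb'
      rcases le_total N (-Real.log δ / (b' - c)) with h | h
      · have := Real.exp_le_exp.2 (mul_le_mul_of_nonneg_left h hc0)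
        have h3 : 0 < δ * Real.exp (b' * N) := by positivity
        linarith
      · rw [div_le_iff₀ hbc] at h
        have h3 : Real.exp (c * N) ≤ δ * Real.exp (b' * N) := by
          nth_rw 1 [← Real.exp_log hδ]
          rw [← Real.exp_add, Real.exp_le_exp]
          linarith
        have h4 := Real.exp_pos (c * (-Real.log δ / (b' - c)))
        linarith
    · filter_upwards [eventually_gt_atTop 0] with k hk using hK k hk
  have hdiff : Tendsto (fun k => ∫ y, f y * Real.exp (quadForm (cs k) (ds k) y)
        ∂(uniformLaw (2 * k) : Measure (EuclideanSpace ℝ (Fin 2))) -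
      ∫ y, f y * Real.exp (quadForm c d y)
        ∂(uniformLaw (2 * k) : Measure (EuclideanSpace ℝ (Fin 2)))) atTop (𝓝 0) := by
    have hη : Tendsto (fun k => ‖f‖ * ((|cs k - c| + |ds k - d|) * ((b' - b)⁻¹ * K))) atTop
        (𝓝 0) := by
      have := ((((hcs.sub_const c).abs.add (hds.sub_const d).abs)).mul_const
        ((b' - b)⁻¹ * K)).const_mul ‖f‖
      simpa using this
    refine squeeze_zero_norm' ?_ hη
    filter_upwards [eventually_gt_atTop 0, hcs.eventually_lt_const hb,
      hds.eventually_lt_const (hdc.trans_lt hb)] with k hk h1 h2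
    rw [← integral_sub (integrable_uniformLaw _ (by fun_prop))
      (integrable_uniformLaw _ (by fun_prop))]
    have hbb : 0 < b' - b := sub_pos.2 hbb'
    calc _ ≤ ∫ y, ‖f‖ * ((|cs k - c| + |ds k - d|) * ((b' - b)⁻¹ *
          Real.exp (quadForm b' b' y)))
          ∂(uniformLaw (2 * k) : Measure (EuclideanSpace ℝ (Fin 2))) := by
          refine norm_integral_le_of_norm_le (integrable_uniformLaw _ (by fun_prop))
            (.of_forall fun y => ?_)
          rw [← mul_sub, norm_mul]
          refine mul_le_mul (f.norm_coe_le_norm y) ?_ (norm_nonneg _) (norm_nonneg _)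
          rw [Real.norm_eq_abs]
          refine (abs_exp_sub_exp_le (quadForm_le h1.le h2.le y)
            (quadForm_le hb.le (hdc.trans hb.le) y)).trans ?_
          rw [quadForm_self b']
          refine (mul_le_mul_of_nonneg_right (abs_quadForm_sub_le _ _ _ _ y)
            (Real.exp_pos _).le).trans ?_
          rw [mul_assoc]
          exact mul_le_mul_of_nonneg_left (mul_exp_le hbb') (by positivity)
      _ ≤ _ := by
          rw [integral_const_mul, integral_const_mul, integral_const_mul]
          gcongr
          exact hK k hk
  simpa using hdiff.add hlim

/-! ### The annealed model as a block Curie-Weiss model -/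

theorem sum_sq_eq_add_two_mul_sum_lt {ι : Type*} [LinearOrder ι] (A : Finset ι) (y : ι → ℝ) :
    (∑ i ∈ A, y i) ^ 2 =
      ∑ i ∈ A, y i ^ 2 + 2 * ∑ e ∈ (A ×ˢ A).filter (fun e => e.1 < e.2), y e.1 * y e.2 := by
  rw [Finset.sum_filter, Finset.sum_product, sq, Finset.sum_mul_sum]
  have h1 : ∀ i ∈ A, ∑ j ∈ A, y i * y j = ∑ j ∈ A, (if i < j then y i * y j else 0) +
      ∑ j ∈ A, (if j < i then y j * y i else 0) + y i ^ 2 := by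
    intro i hi
    have h2 : y i ^ 2 = ∑ j ∈ A, if i = j then y i * y j else 0 := by
      rw [Finset.sum_ite_eq, if_pos hi, sq]
    rw [h2, ← Finset.sum_add_distrib, ← Finset.sum_add_distrib]
    refine Finset.sum_congr rfl fun j _ => ?_
    rcases lt_trichotomy i j with h | h | h
    · simp [h, h.not_gt, h.ne]
    · simp [h]
    · simp [h, h.not_gt, h.ne', mul_comm]
  rw [Finset.sum_congr rfl h1, Finset.sum_add_distrib, Finset.sum_add_distrib]
  rw [Finset.sum_comm (f := fun i j => if j < i then y j * y i else 0)]
  ring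

theorem sum_internalEdges (n : ℕ) (σ : Config n) :
    ∑ e : internalEdges n, spin σ e.1.1 * spin σ e.1.2 =
      (totalSpin₁ σ ^ 2 + totalSpin₂ σ ^ 2 - n) / 2 := by
  have h1 := sum_sq_eq_add_two_mul_sum_lt (community₁ n) (spin σ)
  have h2 := sum_sq_eq_add_two_mul_sum_lt (community₂ n) (spin σ)
  have h3 : ∑ i ∈ community₁ n, spin σ i ^ 2 + ∑ i ∈ community₂ n, spin σ i ^ 2 = n := by
    rw [community₂_eq, community₁, Finset.sum_filter_add_sum_filter_not]
    simp [spin_sq]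
  have h4 : internalEdges n = ((community₁ n ×ˢ community₁ n).filter fun e => e.1 < e.2) ∪
      ((community₂ n ×ˢ community₂ n).filter fun e => e.1 < e.2) := by
    ext e
    simp only [internalEdges, Finset.mem_filter, Finset.mem_univ, true_and, Finset.mem_union,
      Finset.mem_product]
    tauto
  have h5 : Disjoint ((community₁ n ×ˢ community₁ n).filter fun e => e.1 < e.2)
      ((community₂ n ×ˢ community₂ n).filter fun e => e.1 < e.2) := by
    rw [Finset.disjoint_left]
    intro e he he'
    simp only [community₁, community₂, Finset.mem_filter, Finset.mem_product, Finset.mem_univ,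
      true_and] at he he'
    omega
  rw [Finset.sum_coe_sort (internalEdges n) (fun e => spin σ e.1 * spin σ e.2), h4,
    Finset.sum_union h5, totalSpin₁, totalSpin₂, h1, h2]
  linarith

theorem sum_externalEdges (n : ℕ) (σ : Config n) :
    ∑ e : externalEdges n, spin σ e.1.1 * spin σ e.1.2 = totalSpin₁ σ * totalSpin₂ σ := by
  rw [Finset.sum_coe_sort (externalEdges n) (fun e => spin σ e.1 * spin σ e.2), externalEdges,
    Finset.sum_product, totalSpin₁, totalSpin₂, Finset.sum_mul_sum]

/-- The product of `1 + q x y`, over the edges `xy`, with `q = s` for the internal edges and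
`q = r` for the external ones. -/
def annealedWeight (n : ℕ) (s r : ℝ) (σ : Config n) : ℝ :=
  (∏ e : internalEdges n, (1 + s * (spin σ e.1.1 * spin σ e.1.2))) *
    ∏ e : externalEdges n, (1 + r * (spin σ e.1.1 * spin σ e.1.2))

/-- The spin product is `±1`, and `cosh (artanh s) = 1 / √(1 - s²)`, `sinh (artanh s) = s / √(1 -
s²)`. -/
theorem one_add_mul_eq_sqrt_mul_exp {s : ℝ} (hs : s ∈ Set.Ioo (-1) 1) {n : ℕ} (σ : Config n)
    (i j : Fin n) : 1 + s * (spin σ i * spin σ j) =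
      √(1 - s ^ 2) * Real.exp (Real.artanh s * (spin σ i * spin σ j)) := by
  have h1 : 0 < 1 - s ^ 2 := by nlinarith [hs.1, hs.2]
  have h2 : 0 < √(1 - s ^ 2) := Real.sqrt_pos.2 h1
  have h3 := Real.cosh_artanh hs
  have h4 := Real.sinh_artanh hs
  have h5 := Real.cosh_add_sinh (Real.artanh s)
  have h6 := Real.cosh_sub_sinh (Real.artanh s)
  rw [h3, h4] at h5 h6
  have h7 : spin σ i * spin σ j = 1 ∨ spin σ i * spin σ j = -1 := by
    rcases spin_eq_one_or σ i with h | h <;> rcases spin_eq_one_or σ j with h' | h' <;>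
      simp [h, h']
  rcases h7 with h | h
  · rw [h, mul_one, mul_one, ← h5]
    field_simp
  · rw [h, mul_neg_one, mul_neg_one, ← h6]
    field_simp
    ring

/-- In exponential form the exponent sums spin products over complete graphs, hence depends only on
the two total spins. The diagonal terms `σᵢ² = 1` go into `C`. -/
theorem exists_annealedWeight_eq {k : ℕ} (hk : 0 < k) {s r : ℝ} (hs : s ∈ Set.Ioo (-1) 1)
    (hr : r ∈ Set.Ioo (-1) 1) :
    ∃ C, 0 < C ∧ ∀ σ : Config (2 * k), annealedWeight (2 * k) s r σ =
      C * Real.exp (quadForm (k * (Real.artanh s + Real.artanh r) / 2)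
        (k * (Real.artanh s - Real.artanh r) / 2) (scaledMagnetization (2 * k) σ)) := by
  have h1 : 0 < √(1 - s ^ 2) := Real.sqrt_pos.2 (by nlinarith [hs.1, hs.2])
  have h2 : 0 < √(1 - r ^ 2) := Real.sqrt_pos.2 (by nlinarith [hr.1, hr.2])
  have hk' : (0 : ℝ) < k := by exact_mod_cast hk
  refine ⟨√(1 - s ^ 2) ^ Fintype.card (internalEdges (2 * k)) *
    √(1 - r ^ 2) ^ Fintype.card (externalEdges (2 * k)) * Real.exp (-(k * Real.artanh s)),
    by positivity, fun σ => ?_⟩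
  rw [annealedWeight]
  simp_rw [one_add_mul_eq_sqrt_mul_exp hs, one_add_mul_eq_sqrt_mul_exp hr]
  rw [Finset.prod_mul_distrib, Finset.prod_mul_distrib, ← Real.exp_sum, ← Real.exp_sum,
    ← Finset.mul_sum, ← Finset.mul_sum, sum_internalEdges, sum_externalEdges,
    quadForm_scaledMagnetization hk, Finset.prod_const, Finset.prod_const, Finset.card_univ,
    Finset.card_univ, mul_mul_mul_comm, mul_assoc (_ * _), ← Real.exp_add, ← Real.exp_add]
  congr 2
  push_cast
  field_simp
  ring

theorem tendsto_sum_annealedWeight_div {β a : ℝ} (hβ : 0 < β) (ha0 : 0 ≤ a)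
    (h : β * (1 + a) < 2) {s r : ℕ → ℝ} (hs : ∀ᶠ k in atTop, s k ∈ Set.Ioo (-1) 1)
    (hr : ∀ᶠ k in atTop, r k ∈ Set.Ioo (-1) 1)
    (hs' : Tendsto (fun k : ℕ => k * Real.artanh (s k)) atTop (𝓝 (β / 2)))
    (hr' : Tendsto (fun k : ℕ => k * Real.artanh (r k)) atTop (𝓝 (β * a / 2)))
    (f : BoundedContinuousFunction (EuclideanSpace ℝ (Fin 2)) ℝ) :
    Tendsto (fun k : ℕ => (∑ σ, f (scaledMagnetization (2 * k) σ) *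
        annealedWeight (2 * k) (s k) (r k) σ) / ∑ σ, annealedWeight (2 * k) (s k) (r k) σ)
      atTop (𝓝 (∫ y, f y
        ∂(centeredGaussian (limitCov β a) : Measure (EuclideanSpace ℝ (Fin 2))))) := by
  set c := β * (1 + a) / 4 with hcdef
  set d := β * (1 - a) / 4 with hddef
  have hβa : 0 ≤ β * a := mul_nonneg hβ.le ha0
  have hc : 2 * c < 1 := by rw [hcdef]; linarith
  have hd : 2 * d < 1 := by rw [hddef]; linarith
  have h1 : 0 < 1 / (1 - 2 * c) := one_div_pos.2 (by linarith)
  have h2 : 0 < 1 / (1 - 2 * d) := one_div_pos.2 (by linarith)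
  obtain ⟨v, hv⟩ : ∃ v : ℝ≥0, (v : ℝ) = 1 / (1 - 2 * c) := ⟨⟨_, h1.le⟩, rfl⟩
  obtain ⟨w, hw⟩ : ∃ w : ℝ≥0, (w : ℝ) = 1 / (1 - 2 * d) := ⟨⟨_, h2.le⟩, rfl⟩
  have hcs : Tendsto (fun k : ℕ => k * (Real.artanh (s k) + Real.artanh (r k)) / 2) atTop
      (𝓝 c) := by
    convert! (hs'.add hr').div_const 2 using 2
    · ring
    · rw [hcdef]; ring
  have hds : Tendsto (fun k : ℕ => k * (Real.artanh (s k) - Real.artanh (r k)) / 2) atTop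
      (𝓝 d) := by
    convert! (hs'.sub hr').div_const 2 using 2
    · ring
    · rw [hddef]; ring
  have hlim : ∀ g : BoundedContinuousFunction (EuclideanSpace ℝ (Fin 2)) ℝ, _ := fun g =>
    tendsto_integral_uniformLaw_mul_exp (by positivity) (by rw [hcdef, hddef]; linarith) hc
      hcs hds g
  have hvw : 0 < √(v : ℝ) * √(w : ℝ) := by
    rw [hv, hw]; exact mul_pos (Real.sqrt_pos.2 h1) (Real.sqrt_pos.2 h2)
  -- The limits for `f` and for `1` share the total mass `√v √w` of the tilted Gaussian, which drops
  -- out of the quotient.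
  have hf := hlim f
  have hone := hlim (BoundedContinuousFunction.const _ 1)
  rw [integral_rotatedGaussian_mul_exp hv hc hw hd] at hf hone
  have hquot := hf.div hone (by simpa using hvw.ne')
  rw [mul_div_mul_left _ _ hvw.ne'] at hquot
  rw [rotatedGaussian_eq_centeredGaussian hβ ha0 h
    (by rw [hv, hcdef]; rw [div_eq_div_iff (by linarith) (by linarith)]; ring)
    (by rw [hw, hddef]; rw [div_eq_div_iff (by linarith) (by linarith)]; ring)] at hquot
  simp only [BoundedContinuousFunction.const_apply, integral_const, probReal_univ, smul_eq_mul,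
    mul_one, div_one, one_mul] at hquot
  refine hquot.congr' ?_
  filter_upwards [hs, hr, eventually_gt_atTop 0] with k hk1 hk2 hk
  obtain ⟨C, hC, hw⟩ := exists_annealedWeight_eq hk hk1 hk2
  simp_rw [hw]
  rw [Pi.div_apply, integral_uniformLaw _ (by fun_prop), integral_uniformLaw _ (by fun_prop),
    ← Finset.mul_sum]
  simp_rw [mul_left_comm _ C]
  rw [← Finset.mul_sum, mul_div_mul_left _ _ hC.ne', smul_eq_mul, smul_eq_mul,
    mul_div_mul_left _ _ (by positivity)]

/-- With `X = N σ + N τ` and `Y = N (σ τ)`, the exponent `b X + (b' - b) Y` is at most `b' max X Y`.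
So the two-replica sum reduces to one-replica moments, as `τ ↦ σ τ` is a bijection. -/
theorem exists_sum_sum_exp_quadForm_le {b b' : ℝ} (hb : 0 ≤ b) (hbb' : b ≤ b')
    (hb' : 2 * b' < 1) :
    ∃ K, ∀ k : ℕ, 0 < k → ∑ σ : Config (2 * k), ∑ τ : Config (2 * k),
      Real.exp (b * (quadForm 1 1 (scaledMagnetization (2 * k) σ) +
        quadForm 1 1 (scaledMagnetization (2 * k) τ)) +
        (b' - b) * quadForm 1 1 (scaledMagnetization (2 * k) (σ * τ))) ≤
      (2 ^ (2 * k)) ^ 2 * K := by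
  obtain ⟨K, hK⟩ := exists_integral_exp_quadForm_uniformLaw_le (hb.trans hbb') hb'
  refine ⟨K ^ 2 + K, fun k hk => ?_⟩
  have h := hK k hk
  rw [integral_uniformLaw _ (by fun_prop), smul_eq_mul, inv_mul_le_iff₀ (by positivity)] at h
  simp_rw [quadForm_self b'] at h
  set N : Config (2 * k) → ℝ := fun σ => quadForm 1 1 (scaledMagnetization (2 * k) σ)
  have hN : ∀ σ, 0 ≤ N σ := fun σ => quadForm_one_nonneg _
  change ∑ σ, Real.exp (b' * N σ) ≤ _ at h
  calc ∑ σ : Config (2 * k), ∑ τ : Config (2 * k),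
        Real.exp (b * (N σ + N τ) + (b' - b) * N (σ * τ))
      ≤ ∑ σ : Config (2 * k), ∑ τ : Config (2 * k),
        (Real.exp (b' * N σ) * Real.exp (b' * N τ) + Real.exp (b' * N (σ * τ))) := by
        gcongr with σ _ τ _
        rw [← Real.exp_add]
        rcases le_total (N σ + N τ) (N (σ * τ)) with h1 | h1
        · have : b * (N σ + N τ) + (b' - b) * N (σ * τ) ≤ b' * N (σ * τ) := by
            nlinarith [mul_le_mul_of_nonneg_left h1 hb]
          have := Real.exp_le_exp.2 this
          linarith [Real.exp_pos (b' * N σ + b' * N τ)]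
        · have : b * (N σ + N τ) + (b' - b) * N (σ * τ) ≤ b' * N σ + b' * N τ := by
            nlinarith [mul_le_mul_of_nonneg_left h1 (sub_nonneg.2 hbb')]
          have := Real.exp_le_exp.2 this
          linarith [Real.exp_pos (b' * N (σ * τ))]
    _ = (∑ σ, Real.exp (b' * N σ)) ^ 2 + 2 ^ (2 * k) * ∑ σ, Real.exp (b' * N σ) := by
        simp_rw [Finset.sum_add_distrib]
        congr 1
        · rw [sq, Finset.sum_mul_sum]
        · have h1 : ∀ σ : Config (2 * k), ∑ τ : Config (2 * k), Real.exp (b' * N (σ * τ)) =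
              ∑ τ, Real.exp (b' * N τ) := fun σ =>
            Equiv.sum_comp (Equiv.mulLeft σ) (fun τ => Real.exp (b' * N τ))
          simp_rw [h1]
          simp
    _ ≤ (2 ^ (2 * k) * K) ^ 2 + 2 ^ (2 * k) * (2 ^ (2 * k) * K) := by
        gcongr
    _ = (2 ^ (2 * k)) ^ 2 * (K ^ 2 + K) := by ring

/-! ### High-temperature expansion of the Gibbs weights -/

/-- The product of `1 + t ε x y`, over the edges `xy` with edge indicator `ε`. -/
def quenchedWeight (n : ℕ) (t : ℝ) (x : internalEdges n → ℝ) (z : externalEdges n → ℝ)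
    (σ : Config n) : ℝ :=
  (∏ e, (1 + t * x e * (spin σ e.1.1 * spin σ e.1.2))) *
    ∏ e, (1 + t * z e * (spin σ e.1.1 * spin σ e.1.2))

theorem spin_mul_spin_eq_one_or {n : ℕ} (σ : Config n) (i j : Fin n) :
    spin σ i * spin σ j = 1 ∨ spin σ i * spin σ j = -1 := by
  rcases spin_eq_one_or σ i with h | h <;> rcases spin_eq_one_or σ j with h' | h' <;>
    simp [h, h']

theorem exp_mul_eq_cosh_mul {γ ε y : ℝ} (hε : ε = 0 ∨ ε = 1) (hy : y = 1 ∨ y = -1) :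
    Real.exp (γ * (ε * y)) =
      (if ε = 0 then 1 else Real.cosh γ) * (1 + Real.tanh γ * ε * y) := by
  have h := (Real.cosh_pos γ).ne'
  rcases hε with rfl | rfl
  · simp
  · rw [Real.tanh_eq_sinh_div_cosh]
    rcases hy with rfl | rfl
    · simp only [one_ne_zero, if_false, mul_one]
      rw [← Real.cosh_add_sinh]
      field_simp
    · simp only [one_ne_zero, if_false, mul_one, mul_neg]
      rw [← Real.cosh_sub_sinh]
      field_simp
      ring

theorem gibbsWeight_eq_quenchedWeight_div (n : ℕ) (p β : ℝ) {x : internalEdges n → ℝ}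
    {z : externalEdges n → ℝ} (hx : ∀ e, x e = 0 ∨ x e = 1) (hz : ∀ e, z e = 0 ∨ z e = 1)
    (σ : Config n) :
    gibbsWeight n p β x z σ = quenchedWeight n (Real.tanh (β / (n * p))) x z σ /
      ∑ τ, quenchedWeight n (Real.tanh (β / (n * p))) x z τ := by
  set γ := β / (n * p)
  set C := (∏ e, if x e = 0 then 1 else Real.cosh γ) * ∏ e, if z e = 0 then 1 else Real.cosh γ
  have hC : 0 < C := by
    refine mul_pos (Finset.prod_pos fun e _ => ?_) (Finset.prod_pos fun e _ => ?_) <;>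
    · split_ifs
      · exact one_pos
      · exact Real.cosh_pos _
  have h : ∀ τ, Real.exp (-β * hamiltonian n p x z τ) =
      C * quenchedWeight n (Real.tanh γ) x z τ := by
    intro τ
    have h1 : -β * hamiltonian n p x z τ = ∑ e, γ * (x e * (spin τ e.1.1 * spin τ e.1.2)) +
        ∑ e, γ * (z e * (spin τ e.1.1 * spin τ e.1.2)) := by
      rw [hamiltonian, ← Finset.mul_sum, ← Finset.mul_sum, ← mul_add]
      simp only [mul_assoc, γ]
      ring
    rw [h1, Real.exp_add, Real.exp_sum, Real.exp_sum]
    simp_rw [fun e => exp_mul_eq_cosh_mul (γ := γ) (hx e) (spin_mul_spin_eq_one_or τ e.1.1 e.1.2),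
      fun e => exp_mul_eq_cosh_mul (γ := γ) (hz e) (spin_mul_spin_eq_one_or τ e.1.1 e.1.2)]
    rw [Finset.prod_mul_distrib, Finset.prod_mul_distrib, quenchedWeight]
    ring
  rw [gibbsWeight, partitionFunction]
  simp_rw [h]
  rw [← Finset.mul_sum, mul_div_mul_left _ _ hC.ne']

/-! ### First and second moments over the random graph -/

theorem integral_bernoulliMeasure_one_zero (q : unitInterval) (g : ℝ → ℝ) :
    ∫ u, g u ∂(bernoulliMeasure (1 : ℝ) 0 q) = (1 - q) * g 0 + q * g 1 := by
  have h1 : Integrable g (Measure.dirac (1 : ℝ)) := integrable_dirac (by simp)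
  have h2 : Integrable g (Measure.dirac (0 : ℝ)) := integrable_dirac (by simp)
  rw [bernoulliMeasure_def, integral_add_measure (h1.smul_measure_nnreal)
    (h2.smul_measure_nnreal), integral_smul_nnreal_measure, integral_smul_nnreal_measure,
    integral_dirac, integral_dirac, add_comm]
  simp [NNReal.smul_def]

theorem ae_eq_zero_or_eq_one_of_hasLaw {Ω : Type*} [MeasurableSpace Ω] {P : Measure Ω}
    {q : unitInterval} {X : Ω → ℝ} (hX : HasLaw X (bernoulliMeasure (1 : ℝ) 0 q) P) :
    ∀ᵐ ω ∂P, X ω = 0 ∨ X ω = 1 := by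
  have h : ∀ᵐ u ∂(bernoulliMeasure (1 : ℝ) 0 q), u = 0 ∨ u = 1 := by
    rw [ae_iff]
    have hm : MeasurableSet {u : ℝ | ¬(u = 0 ∨ u = 1)} :=
      ((measurableSet_singleton 0).union (measurableSet_singleton 1)).compl
    exact bernoulliMeasure_apply_of_notMem_of_notMem q hm (by simp) (by simp)
  rw [← hX.map_eq] at h
  exact ae_of_ae_map hX.aemeasurable h

section Expectations

variable {Ω : Type*} [MeasurableSpace Ω] {P : Measure Ω} {n : ℕ} {p α : unitInterval}
  {ξ : internalEdges n → Ω → ℝ} {ζ : externalEdges n → Ω → ℝ}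

theorem IsBlockModel.integral_prod_mul_prod (h : IsBlockModel P n p α ξ ζ)
    {g : internalEdges n → ℝ → ℝ} {g' : externalEdges n → ℝ → ℝ} (hg : ∀ e, Continuous (g e))
    (hg' : ∀ e, Continuous (g' e)) :
    ∫ ω, (∏ e, g e (ξ e ω)) * ∏ e, g' e (ζ e ω) ∂P =
      (∏ e, ((1 - p) * g e 0 + p * g e 1)) *
        ∏ e, ((1 - (α * p : unitInterval)) * g' e 0 + (α * p : unitInterval) * g' e 1) := by
  have hm : ∀ e, AEMeasurable (Sum.elim ξ ζ e) P := by
    rintro (e | e)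
    · exact (h.internal_law e).aemeasurable
    · exact (h.external_law e).aemeasurable
  have hc : ∀ e, Continuous (Sum.elim g g' e) := by
    rintro (e | e)
    · exact hg e
    · exact hg' e
  have h1 := h.indep.integral_fun_prod_comp hm (f := Sum.elim g g')
    fun e => (hc e).aestronglyMeasurable
  simp only [Fintype.prod_sum_type, Sum.elim_inl, Sum.elim_inr] at h1
  rw [h1]
  congr 1
  · refine Finset.prod_congr rfl fun e _ => ?_
    rw [← integral_bernoulliMeasure_one_zero]
    exact (h.internal_law e).integral_comp (hg e).aestronglyMeasurable
  · refine Finset.prod_congr rfl fun e _ => ?_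
    rw [← integral_bernoulliMeasure_one_zero]
    exact (h.external_law e).integral_comp (hg' e).aestronglyMeasurable

theorem IsBlockModel.integral_quenchedWeight (h : IsBlockModel P n p α ξ ζ) (t : ℝ)
    (σ : Config n) :
    ∫ ω, quenchedWeight n t (fun e => ξ e ω) (fun e => ζ e ω) σ ∂P =
      annealedWeight n (p * t) (α * p * t) σ := by
  simp only [quenchedWeight]
  rw [h.integral_prod_mul_prod
    (g := fun e u => 1 + t * u * (spin σ e.1.1 * spin σ e.1.2))
    (g' := fun e u => 1 + t * u * (spin σ e.1.1 * spin σ e.1.2))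
    (fun e => by fun_prop) (fun e => by fun_prop), annealedWeight]
  congr 1
  · refine Finset.prod_congr rfl fun e _ => ?_
    ring
  · refine Finset.prod_congr rfl fun e _ => ?_
    rw [Set.Icc.coe_mul]
    ring

/-- The factor of an edge in the second moment, where `x` and `y` are the products of the spins
of its ends in two replicas. -/
def pairFactor (q t x y : ℝ) : ℝ := 1 + q * t * (x + y) + q * t ^ 2 * (x * y)

theorem IsBlockModel.integral_quenchedWeight_mul (h : IsBlockModel P n p α ξ ζ) (t : ℝ)
    (σ τ : Config n) :
    ∫ ω, quenchedWeight n t (fun e => ξ e ω) (fun e => ζ e ω) σ *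
      quenchedWeight n t (fun e => ξ e ω) (fun e => ζ e ω) τ ∂P =
      (∏ e : internalEdges n,
        pairFactor p t (spin σ e.1.1 * spin σ e.1.2) (spin τ e.1.1 * spin τ e.1.2)) *
      ∏ e : externalEdges n,
        pairFactor (α * p) t (spin σ e.1.1 * spin σ e.1.2) (spin τ e.1.1 * spin τ e.1.2) := by
  have hmul : ∀ x z, quenchedWeight n t x z σ * quenchedWeight n t x z τ =
      (∏ e, ((1 + t * x e * (spin σ e.1.1 * spin σ e.1.2)) *
        (1 + t * x e * (spin τ e.1.1 * spin τ e.1.2)))) *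
      ∏ e, ((1 + t * z e * (spin σ e.1.1 * spin σ e.1.2)) *
        (1 + t * z e * (spin τ e.1.1 * spin τ e.1.2))) := by
    intro x z
    rw [quenchedWeight, quenchedWeight, mul_mul_mul_comm, ← Finset.prod_mul_distrib,
      ← Finset.prod_mul_distrib]
  simp_rw [hmul]
  rw [h.integral_prod_mul_prod
    (g := fun e u => (1 + t * u * (spin σ e.1.1 * spin σ e.1.2)) *
      (1 + t * u * (spin τ e.1.1 * spin τ e.1.2)))
    (g' := fun e u => (1 + t * u * (spin σ e.1.1 * spin σ e.1.2)) *
      (1 + t * u * (spin τ e.1.1 * spin τ e.1.2)))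
    (fun e => by fun_prop) (fun e => by fun_prop)]
  congr 1
  · refine Finset.prod_congr rfl fun e _ => ?_
    rw [pairFactor]
    ring
  · refine Finset.prod_congr rfl fun e _ => ?_
    rw [Set.Icc.coe_mul, pairFactor]
    ring

theorem pairFactor_nonneg {q t x y : ℝ} (hq0 : 0 ≤ q) (hq1 : q ≤ 1) (ht0 : 0 ≤ t) (ht1 : t ≤ 1)
    (hx : x = 1 ∨ x = -1) (hy : y = 1 ∨ y = -1) : 0 ≤ pairFactor q t x y := by
  -- The factor as the expectation over one Bernoulli edge indicator.
  have h : pairFactor q t x y = (1 - q) + q * ((1 + t * x) * (1 + t * y)) := by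
    rw [pairFactor]; ring
  have hx' : 0 ≤ 1 + t * x := by rcases hx with rfl | rfl <;> linarith
  have hy' : 0 ≤ 1 + t * y := by rcases hy with rfl | rfl <;> linarith
  rw [h]
  have := mul_nonneg hq0 (mul_nonneg hx' hy')
  linarith

/-- The pair factor is `A + ρ x y`, with `A = (1 + h x) (1 + h y)` the product of the means and `ρ`
the edge covariance. By `1 + z ≤ exp z` it suffices that `(A - 1) ρ x y + A E ≥ 0`. As `h ≤ 1 / 2`,
one has `A ≥ 1 / 4` and `|A - 1| ≤ 5 h / 2`, whence the `10 = 4 · 5 / 2` in `E`. The error is stated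
with `p` to serve both kinds of edges. -/
theorem pairFactor_le {q p t x y : ℝ} (hq0 : 0 ≤ q) (hqp : q ≤ p) (hp1 : p ≤ 1) (ht0 : 0 ≤ t)
    (hpt : p * t ≤ 1 / 2) (hx : x = 1 ∨ x = -1) (hy : y = 1 ∨ y = -1) :
    pairFactor q t x y ≤ (1 + q * t * x) * (1 + q * t * y) *
      Real.exp (q * (1 - q) * t ^ 2 * (x * y) + 10 * p ^ 2 * t ^ 3) := by
  set h := q * t with hdef
  set ρ := q * (1 - q) * t ^ 2 with hρ
  set E := 10 * p ^ 2 * t ^ 3 with hE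
  have hh0 : 0 ≤ h := mul_nonneg hq0 ht0
  have hh : h ≤ 1 / 2 := (mul_le_mul_of_nonneg_right hqp ht0).trans hpt
  have hρ0 : 0 ≤ ρ := mul_nonneg (mul_nonneg hq0 (by linarith)) (sq_nonneg _)
  have hEρ : 10 * h * ρ ≤ E := by
    have h1 : q * (1 - q) ≤ p := by nlinarith
    have h2 : q * (q * (1 - q)) ≤ p * p :=
      mul_le_mul hqp h1 (mul_nonneg hq0 (by linarith)) (hq0.trans hqp)
    have h3 := mul_le_mul_of_nonneg_right h2 (pow_nonneg ht0 3)
    rw [hE, hρ, hdef]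
    nlinarith
  have hA : pairFactor q t x y = (1 + h * x) * (1 + h * y) + ρ * (x * y) := by
    rw [pairFactor, hdef, hρ]; ring
  have hA0 : 1 / 4 ≤ (1 + h * x) * (1 + h * y) := by
    have hx' : 1 / 2 ≤ 1 + h * x := by rcases hx with rfl | rfl <;> linarith
    have hy' : 1 / 2 ≤ 1 + h * y := by rcases hy with rfl | rfl <;> linarith
    nlinarith
  have hA1 : -(5 / 2 * h * ρ) ≤ ((1 + h * x) * (1 + h * y) - 1) * (ρ * (x * y)) := by
    have hρh : 0 ≤ h * ρ := mul_nonneg hh0 hρ0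
    have hρh2 : 0 ≤ h * h * ρ := mul_nonneg (mul_nonneg hh0 hh0) hρ0
    have hρh3 : 0 ≤ (1 / 2 - h) * (h * ρ) := mul_nonneg (sub_nonneg.2 hh) hρh
    rcases hx with rfl | rfl <;> rcases hy with rfl | rfl <;> nlinarith
  rw [hA]
  have h4 := Real.add_one_le_exp (ρ * (x * y) + E)
  have h5 : (1 + h * x) * (1 + h * y) * (ρ * (x * y) + E + 1) ≤
      (1 + h * x) * (1 + h * y) * Real.exp (ρ * (x * y) + E) :=
    mul_le_mul_of_nonneg_left h4 (by linarith)
  have hE0 : 0 ≤ E := le_trans (by positivity) hEρ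
  have h6 : 1 / 4 * E ≤ (1 + h * x) * (1 + h * y) * E := mul_le_mul_of_nonneg_right hA0 hE0
  nlinarith

theorem spin_mul {n : ℕ} (σ τ : Config n) (i : Fin n) : spin (σ * τ) i = spin σ i * spin τ i := by
  simp [spin]

theorem card_internalEdges_le (n : ℕ) : (Fintype.card (internalEdges n) : ℝ) ≤ (n : ℝ) ^ 2 := by
  rw [Fintype.card_coe]
  have h := Finset.card_le_univ (internalEdges n)
  rw [Fintype.card_prod, Fintype.card_fin] at h
  rw [sq]
  exact_mod_cast h

theorem card_externalEdges_le (n : ℕ) : (Fintype.card (externalEdges n) : ℝ) ≤ (n : ℝ) ^ 2 := by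
  rw [Fintype.card_coe]
  have h := Finset.card_le_univ (externalEdges n)
  rw [Fintype.card_prod, Fintype.card_fin] at h
  rw [sq]
  exact_mod_cast h

theorem annealedWeight_pos {n : ℕ} {s r : ℝ} (hs : s ∈ Set.Ioo (-1) 1) (hr : r ∈ Set.Ioo (-1) 1)
    (σ : Config n) : 0 < annealedWeight n s r σ := by
  refine mul_pos (Finset.prod_pos fun e _ => ?_) (Finset.prod_pos fun e _ => ?_)
  · rcases spin_mul_spin_eq_one_or σ e.1.1 e.1.2 with h | h <;> rw [h] <;> linarith [hs.1, hs.2]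
  · rcases spin_mul_spin_eq_one_or σ e.1.1 e.1.2 with h | h <;> rw [h] <;> linarith [hr.1, hr.2]

theorem sum_mul_add_const {ι : Type*} [Fintype ι] (c E : ℝ) (g : ι → ℝ) :
    ∑ i, (c * g i + E) = c * ∑ i, g i + Fintype.card ι * E := by
  rw [Finset.sum_add_distrib, ← Finset.mul_sum, Finset.sum_const, Finset.card_univ, nsmul_eq_mul]

/-- The edge correlations add up to the pair energy of the single configuration `σ * τ`, hence to a
quadratic form in its total spins. Each kind of edge contributes at most `n²` errors `10 p² t³`. -/
theorem prod_pairFactor_le {k : ℕ} (hk : 0 < k) {p a t : ℝ} (hp0 : 0 ≤ p) (hp1 : p ≤ 1)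
    (ha0 : 0 ≤ a) (ha1 : a ≤ 1) (ht0 : 0 ≤ t) (ht1 : t ≤ 1) (hpt : p * t ≤ 1 / 2)
    (σ τ : Config (2 * k)) :
    (∏ e : internalEdges (2 * k),
        pairFactor p t (spin σ e.1.1 * spin σ e.1.2) (spin τ e.1.1 * spin τ e.1.2)) *
      ∏ e : externalEdges (2 * k),
        pairFactor (a * p) t (spin σ e.1.1 * spin σ e.1.2) (spin τ e.1.1 * spin τ e.1.2) ≤
    annealedWeight (2 * k) (p * t) (a * p * t) σ * annealedWeight (2 * k) (p * t) (a * p * t) τ *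
      Real.exp (k * p * t ^ 2 * quadForm 1 1 (scaledMagnetization (2 * k) (σ * τ)) +
        20 * (2 * k : ℕ) ^ 2 * p ^ 2 * t ^ 3) := by
  have hap0 : 0 ≤ a * p := mul_nonneg ha0 hp0
  have hap : a * p ≤ p := mul_le_of_le_one_left hp0 ha1
  set x : Fin (2 * k) × Fin (2 * k) → ℝ := fun e => spin σ e.1 * spin σ e.2
  set y : Fin (2 * k) × Fin (2 * k) → ℝ := fun e => spin τ e.1 * spin τ e.2
  have hx : ∀ e, x e = 1 ∨ x e = -1 := fun e => spin_mul_spin_eq_one_or σ e.1 e.2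
  have hy : ∀ e, y e = 1 ∨ y e = -1 := fun e => spin_mul_spin_eq_one_or τ e.1 e.2
  have hxy : ∀ e, x e * y e = spin (σ * τ) e.1 * spin (σ * τ) e.2 := fun e => by
    simp only [x, y, spin_mul]; ring
  have hE : 0 ≤ 10 * p ^ 2 * t ^ 3 := by positivity
  have h1 : ∏ e : internalEdges (2 * k), pairFactor p t (x e.1) (y e.1) ≤
      ∏ e : internalEdges (2 * k), ((1 + p * t * x e.1) * (1 + p * t * y e.1) *
        Real.exp (p * (1 - p) * t ^ 2 * (x e.1 * y e.1) + 10 * p ^ 2 * t ^ 3)) :=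
    Finset.prod_le_prod (fun e _ => pairFactor_nonneg hp0 hp1 ht0 ht1 (hx _) (hy _))
      fun e _ => pairFactor_le hp0 le_rfl hp1 ht0 hpt (hx _) (hy _)
  have h2 : ∏ e : externalEdges (2 * k), pairFactor (a * p) t (x e.1) (y e.1) ≤
      ∏ e : externalEdges (2 * k), ((1 + a * p * t * x e.1) * (1 + a * p * t * y e.1) *
        Real.exp (a * p * (1 - a * p) * t ^ 2 * (x e.1 * y e.1) + 10 * p ^ 2 * t ^ 3)) :=
    Finset.prod_le_prod (fun e _ => pairFactor_nonneg hap0 (hap.trans hp1) ht0 ht1 (hx _) (hy _))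
      fun e _ => pairFactor_le hap0 hap hp1 ht0 hpt (hx _) (hy _)
  refine (mul_le_mul h1 h2 (Finset.prod_nonneg fun e _ => pairFactor_nonneg hap0 (hap.trans hp1)
    ht0 ht1 (hx _) (hy _)) ((Finset.prod_nonneg fun e _ => pairFactor_nonneg hp0 hp1 ht0 ht1
    (hx _) (hy _)).trans h1)).trans ?_
  simp_rw [Finset.prod_mul_distrib]
  simp_rw [hxy]
  rw [← Real.exp_sum, ← Real.exp_sum, sum_mul_add_const, sum_mul_add_const, sum_internalEdges,
    sum_externalEdges, mul_mul_mul_comm, ← Real.exp_add, mul_mul_mul_comm (∏ _, _)]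
  have hs1 : p * t ∈ Set.Ioo (-1) 1 := ⟨by linarith [mul_nonneg hp0 ht0], by linarith⟩
  have hs2 : a * p * t ∈ Set.Ioo (-1) 1 :=
    ⟨by linarith [mul_nonneg hap0 ht0], by linarith [mul_le_mul_of_nonneg_right hap ht0]⟩
  refine mul_le_mul_of_nonneg_left (Real.exp_le_exp.2 ?_)
    (mul_pos (annealedWeight_pos hs1 hs2 σ) (annealedWeight_pos hs1 hs2 τ)).le
  have hk' : (0 : ℝ) < k := by exact_mod_cast hk
  have hN : k * quadForm 1 1 (scaledMagnetization (2 * k) (σ * τ)) =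
      totalSpin₁ (σ * τ) ^ 2 + totalSpin₂ (σ * τ) ^ 2 := by
    rw [quadForm_scaledMagnetization hk]
    field_simp
    ring
  set R := totalSpin₁ (σ * τ)
  set R' := totalSpin₂ (σ * τ)
  have hc1 := mul_le_mul_of_nonneg_right (card_internalEdges_le (2 * k)) hE
  have hc2 := mul_le_mul_of_nonneg_right (card_externalEdges_le (2 * k)) hE
  have ht2 := sq_nonneg t
  have hi : p * (1 - p) * t ^ 2 ≤ p * t ^ 2 := by
    refine mul_le_mul_of_nonneg_right ?_ ht2
    nlinarith
  have he : a * p * (1 - a * p) * t ^ 2 ≤ p * t ^ 2 := by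
    refine mul_le_mul_of_nonneg_right ?_ ht2
    nlinarith
  have hi0 : 0 ≤ p * (1 - p) * t ^ 2 := mul_nonneg (mul_nonneg hp0 (by linarith)) ht2
  have he0 : 0 ≤ a * p * (1 - a * p) * t ^ 2 := mul_nonneg (mul_nonneg hap0 (by linarith)) ht2
  -- Crude bounds suffice: each kind of edge gives at most half of `p t² (R² + R'²)`, and this
  -- coefficient is small relative to `1 / k`.
  have hA : p * (1 - p) * t ^ 2 * ((R ^ 2 + R' ^ 2 - (2 * k : ℕ)) / 2) ≤
      p * t ^ 2 * ((R ^ 2 + R' ^ 2) / 2) := by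
    refine (mul_le_mul_of_nonneg_left (?_ : _ ≤ (R ^ 2 + R' ^ 2) / 2) hi0).trans
      (mul_le_mul_of_nonneg_right hi (by positivity))
    have : (0 : ℝ) ≤ (2 * k : ℕ) := by positivity
    linarith
  have hB : a * p * (1 - a * p) * t ^ 2 * (R * R') ≤ p * t ^ 2 * ((R ^ 2 + R' ^ 2) / 2) := by
    refine (mul_le_mul_of_nonneg_left (?_ : _ ≤ (R ^ 2 + R' ^ 2) / 2) he0).trans
      (mul_le_mul_of_nonneg_right he (by positivity))
    nlinarith [sq_nonneg (R - R')]
  have hM : k * p * t ^ 2 * quadForm 1 1 (scaledMagnetization (2 * k) (σ * τ)) =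
      p * t ^ 2 * (R ^ 2 + R' ^ 2) := by rw [← hN]; ring
  rw [hM]
  linarith

end Expectations

/-! ### Integrability, variance and Chebyshev's inequality -/

theorem abs_prod_one_add_le {ι : Type*} [Fintype ι] {t : ℝ} {x y : ι → ℝ}
    (hx : ∀ i, x i = 0 ∨ x i = 1) (hy : ∀ i, y i = 1 ∨ y i = -1) :
    |∏ i, (1 + t * x i * y i)| ≤ (1 + |t|) ^ Fintype.card ι := by
  rw [Finset.abs_prod, ← Finset.card_univ, ← Finset.prod_const]
  refine Finset.prod_le_prod (fun i _ => abs_nonneg _) fun i _ => ?_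
  refine (abs_add_le _ _).trans ?_
  rw [abs_one, abs_mul, abs_mul]
  have hx' : |x i| ≤ 1 := by rcases hx i with h | h <;> simp [h]
  have hy' : |y i| = 1 := by rcases hy i with h | h <;> simp [h]
  rw [hy', mul_one]
  have := mul_le_mul_of_nonneg_left hx' (abs_nonneg t)
  linarith

theorem IsBlockModel.ae_internal {Ω : Type*} [MeasurableSpace Ω] {P : Measure Ω} {n : ℕ}
    {p α : unitInterval} {ξ : internalEdges n → Ω → ℝ} {ζ : externalEdges n → Ω → ℝ}
    (h : IsBlockModel P n p α ξ ζ) : ∀ᵐ ω ∂P, ∀ e, ξ e ω = 0 ∨ ξ e ω = 1 :=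
  ae_all_iff.2 fun e => ae_eq_zero_or_eq_one_of_hasLaw (h.internal_law e)

theorem IsBlockModel.ae_external {Ω : Type*} [MeasurableSpace Ω] {P : Measure Ω} {n : ℕ}
    {p α : unitInterval} {ξ : internalEdges n → Ω → ℝ} {ζ : externalEdges n → Ω → ℝ}
    (h : IsBlockModel P n p α ξ ζ) : ∀ᵐ ω ∂P, ∀ e, ζ e ω = 0 ∨ ζ e ω = 1 :=
  ae_all_iff.2 fun e => ae_eq_zero_or_eq_one_of_hasLaw (h.external_law e)

section Variance

variable {Ω : Type*} [MeasurableSpace Ω] {P : Measure Ω} {n : ℕ}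
  {p α : unitInterval} {ξ : internalEdges n → Ω → ℝ} {ζ : externalEdges n → Ω → ℝ}

theorem IsBlockModel.aemeasurable_quenchedWeight (h : IsBlockModel P n p α ξ ζ) (t : ℝ)
    (σ : Config n) :
    AEMeasurable (fun ω => quenchedWeight n t (fun e => ξ e ω) (fun e => ζ e ω) σ) P := by
  simp only [quenchedWeight]
  refine AEMeasurable.mul ?_ ?_
  · refine Finset.aemeasurable_fun_prod _ fun e _ => ?_
    exact (((h.internal_law e).aemeasurable.const_mul t).mul_const _).const_add 1
  · refine Finset.aemeasurable_fun_prod _ fun e _ => ?_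
    exact (((h.external_law e).aemeasurable.const_mul t).mul_const _).const_add 1

theorem IsBlockModel.exists_abs_quenchedWeight_le (h : IsBlockModel P n p α ξ ζ) (t : ℝ) :
    ∃ B, 0 ≤ B ∧ ∀ σ : Config n, ∀ᵐ ω ∂P,
      |quenchedWeight n t (fun e => ξ e ω) (fun e => ζ e ω) σ| ≤ B := by
  refine ⟨(1 + |t|) ^ Fintype.card (internalEdges n) * (1 + |t|) ^ Fintype.card (externalEdges n),
    by positivity, fun σ => ?_⟩
  filter_upwards [h.ae_internal, h.ae_external] with ω h1 h2
  rw [quenchedWeight, abs_mul]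
  exact mul_le_mul (abs_prod_one_add_le h1 fun e => spin_mul_spin_eq_one_or σ e.1.1 e.1.2)
    (abs_prod_one_add_le h2 fun e => spin_mul_spin_eq_one_or σ e.1.1 e.1.2) (abs_nonneg _)
    (by positivity)

variable [IsProbabilityMeasure P]

theorem IsBlockModel.integrable_quenchedWeight (h : IsBlockModel P n p α ξ ζ) (t : ℝ)
    (σ : Config n) :
    Integrable (fun ω => quenchedWeight n t (fun e => ξ e ω) (fun e => ζ e ω) σ) P := by
  obtain ⟨B, -, hB⟩ := h.exists_abs_quenchedWeight_le t
  exact Integrable.of_bound (h.aemeasurable_quenchedWeight t σ).aestronglyMeasurable B (hB σ)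

theorem IsBlockModel.integrable_quenchedWeight_mul (h : IsBlockModel P n p α ξ ζ) (t : ℝ)
    (σ τ : Config n) :
    Integrable (fun ω => quenchedWeight n t (fun e => ξ e ω) (fun e => ζ e ω) σ *
      quenchedWeight n t (fun e => ξ e ω) (fun e => ζ e ω) τ) P := by
  obtain ⟨B, -, hB⟩ := h.exists_abs_quenchedWeight_le t
  exact (h.integrable_quenchedWeight t τ).bdd_mul
    (h.aemeasurable_quenchedWeight t σ).aestronglyMeasurable (hB σ)

theorem integral_sq_sum_sub_sum_integral {ι : Type*} [Fintype ι] {D : ι → Ω → ℝ}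
    (hD : ∀ i, Integrable (D i) P) (hDD : ∀ i j, Integrable (fun ω => D i ω * D j ω) P)
    (F : ι → ℝ) :
    Integrable (fun ω => (∑ i, F i * D i ω - ∑ i, F i * ∫ ω, D i ω ∂P) ^ 2) P ∧
    ∫ ω, (∑ i, F i * D i ω - ∑ i, F i * ∫ ω, D i ω ∂P) ^ 2 ∂P =
      ∑ i, ∑ j, F i * F j * (∫ ω, D i ω * D j ω ∂P - (∫ ω, D i ω ∂P) * ∫ ω, D j ω ∂P) := by
  set m : ι → ℝ := fun i => ∫ ω, D i ω ∂P
  have h : ∀ ω, (∑ i, F i * D i ω - ∑ i, F i * m i) ^ 2 =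
      ∑ i, ∑ j, F i * F j * (D i ω * D j ω - m j * D i ω - m i * D j ω + m i * m j) := by
    intro ω
    rw [← Finset.sum_sub_distrib, sq, Finset.sum_mul_sum]
    refine Finset.sum_congr rfl fun i _ => Finset.sum_congr rfl fun j _ => ?_
    ring
  have hint : ∀ i j, Integrable (fun ω => D i ω * D j ω - m j * D i ω - m i * D j ω + m i * m j)
      P := fun i j =>
    (((hDD i j).sub ((hD i).const_mul _)).sub ((hD j).const_mul _)).add (integrable_const _)
  change Integrable (fun ω => (∑ i, F i * D i ω - ∑ i, F i * m i) ^ 2) P ∧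
    ∫ ω, (∑ i, F i * D i ω - ∑ i, F i * m i) ^ 2 ∂P =
      ∑ i, ∑ j, F i * F j * (∫ ω, D i ω * D j ω ∂P - m i * m j)
  simp_rw [h]
  refine ⟨integrable_finsetSum _ fun i _ => integrable_finsetSum _ fun j _ =>
    (hint i j).const_mul _, ?_⟩
  rw [integral_finsetSum _ fun i _ => integrable_finsetSum _ fun j _ => (hint i j).const_mul _]
  refine Finset.sum_congr rfl fun i _ => ?_
  rw [integral_finsetSum _ fun j _ => (hint i j).const_mul _]
  refine Finset.sum_congr rfl fun j _ => ?_
  have i1 : Integrable (fun ω => m j * D i ω) P := (hD i).const_mul _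
  have i2 : Integrable (fun ω => m i * D j ω) P := (hD j).const_mul _
  have i3 : Integrable (fun ω => D i ω * D j ω - m j * D i ω) P := (hDD i j).sub i1
  have i4 : Integrable (fun ω => D i ω * D j ω - m j * D i ω - m i * D j ω) P := i3.sub i2
  rw [integral_const_mul, integral_add i4 (integrable_const _), integral_sub i3 i2,
    integral_sub (hDD i j) i1, integral_const_mul, integral_const_mul]
  simp only [integral_const, probReal_univ, one_smul]
  simp only [m]
  ring

/-- The relative variance of the quenched partition function, up to a constant. -/
def relativeVariance (k : ℕ) (p a t : ℝ) : ℝ :=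
  (∑ σ : Config (2 * k), ∑ τ : Config (2 * k),
    annealedWeight (2 * k) (p * t) (a * p * t) σ * annealedWeight (2 * k) (p * t) (a * p * t) τ *
      (Real.exp (k * p * t ^ 2 * quadForm 1 1 (scaledMagnetization (2 * k) (σ * τ)) +
        20 * (2 * k : ℕ) ^ 2 * p ^ 2 * t ^ 3) - 1)) /
    (∑ σ : Config (2 * k), annealedWeight (2 * k) (p * t) (a * p * t) σ) ^ 2

/-- Chebyshev's inequality. The covariances are bounded only from above, so `F` must be nonnegative
for the bound to survive multiplication by `F σ * F τ`. -/
theorem IsBlockModel.measureReal_le {k : ℕ} (hk : 0 < k) {p α : unitInterval}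
    {ξ : internalEdges (2 * k) → Ω → ℝ} {ζ : externalEdges (2 * k) → Ω → ℝ}
    (h : IsBlockModel P (2 * k) p α ξ ζ) {t : ℝ} (ht0 : 0 ≤ t) (ht1 : t ≤ 1)
    (hpt : p * t ≤ 1 / 2) {F : Config (2 * k) → ℝ} {B : ℝ} (hF0 : ∀ σ, 0 ≤ F σ)
    (hFB : ∀ σ, F σ ≤ B) {η : ℝ} (hη : 0 < η) :
    P.real {ω | η * ∑ σ, annealedWeight (2 * k) (p * t) (α * p * t) σ ≤
      |∑ σ, F σ * quenchedWeight (2 * k) t (fun e => ξ e ω) (fun e => ζ e ω) σ -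
        ∑ σ, F σ * annealedWeight (2 * k) (p * t) (α * p * t) σ|} ≤
      B ^ 2 * relativeVariance k p α t / η ^ 2 := by
  set w := annealedWeight (2 * k) (p * t) (α * p * t) with hw
  have hap : (α : ℝ) * p ≤ p := mul_le_of_le_one_left p.2.1 α.2.2
  have hap0 : 0 ≤ (α : ℝ) * p := mul_nonneg α.2.1 p.2.1
  have hs1 : p * t ∈ Set.Ioo (-1 : ℝ) 1 := ⟨by linarith [mul_nonneg p.2.1 ht0], by linarith⟩
  have hs2 : α * p * t ∈ Set.Ioo (-1 : ℝ) 1 :=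
    ⟨by linarith [mul_nonneg hap0 ht0], by linarith [mul_le_mul_of_nonneg_right hap ht0]⟩
  have hwpos : ∀ σ, 0 < w σ := annealedWeight_pos hs1 hs2
  have hM : 0 < ∑ σ, w σ := Finset.sum_pos (fun σ _ => hwpos σ) Finset.univ_nonempty
  obtain ⟨hint, hsq⟩ := integral_sq_sum_sub_sum_integral
    (D := fun σ ω => quenchedWeight (2 * k) t (fun e => ξ e ω) (fun e => ζ e ω) σ)
    (fun σ => h.integrable_quenchedWeight t σ) (fun σ τ => h.integrable_quenchedWeight_mul t σ τ) F
  simp only [h.integral_quenchedWeight, h.integral_quenchedWeight_mul] at hint hsq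
  have hcheb := mul_meas_ge_le_integral_of_nonneg (.of_forall fun ω => sq_nonneg _) hint
    ((η * ∑ σ, w σ) ^ 2)
  rw [hsq] at hcheb
  have hset : {ω | η * ∑ σ, w σ ≤
      |∑ σ, F σ * quenchedWeight (2 * k) t (fun e => ξ e ω) (fun e => ζ e ω) σ -
        ∑ σ, F σ * w σ|} = {ω | (η * ∑ σ, w σ) ^ 2 ≤
      (∑ σ, F σ * quenchedWeight (2 * k) t (fun e => ξ e ω) (fun e => ζ e ω) σ -
        ∑ σ, F σ * w σ) ^ 2} := by
    ext ω
    rw [Set.mem_ofPred_eq, Set.mem_ofPred_eq, sq_le_sq, abs_of_pos (mul_pos hη hM)]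
  rw [hset, relativeVariance, ← hw]
  rw [mul_div_assoc', div_div, ← mul_pow, le_div_iff₀ (by positivity), mul_comm _ η, mul_comm]
  refine hcheb.trans ?_
  rw [Finset.mul_sum]
  refine Finset.sum_le_sum fun σ _ => ?_
  rw [Finset.mul_sum]
  refine Finset.sum_le_sum fun τ _ => ?_
  have h1 := prod_pairFactor_le hk p.2.1 p.2.2 α.2.1 α.2.2 ht0 ht1 hpt σ τ
  have h2 : (0 : ℝ) ≤ k * p * t ^ 2 * quadForm 1 1 (scaledMagnetization (2 * k) (σ * τ)) +
        20 * (2 * k : ℕ) ^ 2 * p ^ 2 * t ^ 3 := by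
    have := quadForm_one_nonneg (scaledMagnetization (2 * k) (σ * τ))
    have := p.2.1
    positivity
  have hF2 : F σ * F τ ≤ B ^ 2 := by
    rw [sq]; exact mul_le_mul (hFB σ) (hFB τ) (hF0 τ) ((hF0 σ).trans (hFB σ))
  refine (mul_le_mul_of_nonneg_left (sub_le_sub_right h1 _)
    (mul_nonneg (hF0 σ) (hF0 τ))).trans ?_
  rw [← hw, show ∀ u v : ℝ, u * v - u = u * (v - 1) by intros; ring]
  refine mul_le_mul_of_nonneg_right hF2 (mul_nonneg (mul_pos (hwpos σ) (hwpos τ)).le ?_)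
  linarith [Real.add_one_le_exp (k * p * t ^ 2 *
    quadForm 1 1 (scaledMagnetization (2 * k) (σ * τ)) + 20 * (2 * k : ℕ) ^ 2 * p ^ 2 * t ^ 3)]

end Variance

/-! ### Asymptotics of the parameters and of the relative variance -/

theorem hasDerivAt_tanh_zero : HasDerivAt Real.tanh 1 0 := by
  have h := (Real.hasDerivAt_sinh 0).div (Real.hasDerivAt_cosh 0) (by simp)
  have h2 : Real.tanh = Real.sinh / Real.cosh := by
    ext x
    exact Real.tanh_eq_sinh_div_cosh x
  rw [h2]
  simpa using h

theorem hasDerivAt_artanh_zero : HasDerivAt Real.artanh 1 0 := by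
  have h1 : HasDerivAt (fun x : ℝ => (1 + x) / (1 - x)) 2 0 := by
    have := ((hasDerivAt_id (0 : ℝ)).const_add 1).div ((hasDerivAt_id (0 : ℝ)).const_sub 1)
      (by simp)
    convert! this using 1
    simp
    norm_num
  have h2 := (h1.log (by simp)).const_mul (1 / 2)
  have h3 : HasDerivAt (fun x : ℝ => 1 / 2 * Real.log ((1 + x) / (1 - x))) 1 0 := by
    convert! h2 using 1
    norm_num
  refine h3.congr_of_eventuallyEq ?_
  filter_upwards [Icc_mem_nhds (show (-1 : ℝ) < 0 by norm_num) (show (0 : ℝ) < 1 by norm_num)]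
    with x hx using Real.artanh_eq_half_log hx

theorem tanh_nonneg {x : ℝ} (hx : 0 ≤ x) : 0 ≤ Real.tanh x := by
  rw [Real.tanh_eq_sinh_div_cosh]
  exact div_nonneg (Real.sinh_nonneg_iff.2 hx) (Real.cosh_pos x).le

section Asymptotics

variable {β a : ℝ} {p α : ℕ → ℝ}

/-- The parameter `tanh (β / (n p))` of the high-temperature expansion, for `n = 2k`. -/
def tanhParameter (β : ℝ) (p : ℕ → ℝ) (k : ℕ) : ℝ := Real.tanh (β / ((2 * k : ℕ) * p k))

theorem tendsto_mul_tanhParameter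
    (hnp : Tendsto (fun k : ℕ => ((2 * k : ℕ) : ℝ) * p k) atTop atTop) :
    Tendsto (fun k : ℕ => ((2 * k : ℕ) : ℝ) * p k * tanhParameter β p k) atTop (𝓝 β) := by
  refine tendsto_mul_of_hasDerivAt hasDerivAt_tanh_zero Real.tanh_zero hnp ?_
  refine tendsto_const_nhds.congr' ?_
  filter_upwards [hnp.eventually_gt_atTop 0] with k hk
  rw [mul_div_cancel₀ _ hk.ne']

theorem tendsto_natCast_mul_tanhParameter
    (hnp : Tendsto (fun k : ℕ => ((2 * k : ℕ) : ℝ) * p k) atTop atTop) :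
    Tendsto (fun k : ℕ => (k : ℝ) * (p k * tanhParameter β p k)) atTop (𝓝 (β / 2)) := by
  refine ((tendsto_mul_tanhParameter (β := β) hnp).div_const 2).congr fun k => ?_
  push_cast
  ring

theorem tendsto_natCast_mul_mul_tanhParameter
    (hnp : Tendsto (fun k : ℕ => ((2 * k : ℕ) : ℝ) * p k) atTop atTop)
    (hα : Tendsto α atTop (𝓝 a)) :
    Tendsto (fun k : ℕ => (k : ℝ) * (α k * p k * tanhParameter β p k)) atTop
      (𝓝 (β * a / 2)) := by
  have h := (tendsto_natCast_mul_tanhParameter (β := β) hnp).mul hα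
  rw [div_mul_eq_mul_div] at h
  refine h.congr fun k => ?_
  ring

theorem tendsto_zero_of_tendsto_natCast_mul {x : ℕ → ℝ} {L : ℝ}
    (h : Tendsto (fun k : ℕ => (k : ℝ) * x k) atTop (𝓝 L)) : Tendsto x atTop (𝓝 0) := by
  have h1 := h.mul tendsto_inv_atTop_nhds_zero_nat
  rw [mul_zero] at h1
  refine h1.congr' ?_
  filter_upwards [eventually_gt_atTop 0] with k hk
  have : (0 : ℝ) < k := by exact_mod_cast hk
  field_simp

theorem eventually_mem_Ioo_of_tendsto_natCast_mul {x : ℕ → ℝ} {L : ℝ}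
    (h : Tendsto (fun k : ℕ => (k : ℝ) * x k) atTop (𝓝 L)) :
    ∀ᶠ k in atTop, x k ∈ Set.Ioo (-1) 1 :=
  (tendsto_zero_of_tendsto_natCast_mul h).eventually
    (Ioo_mem_nhds (show (-1 : ℝ) < 0 by norm_num) (show (0 : ℝ) < 1 by norm_num))

theorem tendsto_natCast_mul_artanh {x : ℕ → ℝ} {L : ℝ}
    (h : Tendsto (fun k : ℕ => (k : ℝ) * x k) atTop (𝓝 L)) :
    Tendsto (fun k : ℕ => (k : ℝ) * Real.artanh (x k)) atTop (𝓝 L) :=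
  tendsto_mul_of_hasDerivAt hasDerivAt_artanh_zero Real.artanh_zero tendsto_natCast_atTop_atTop h

theorem exp_mul_sub_one_le {δ δ₀ X : ℝ} (hδ : 0 ≤ δ) (hδ₀ : 0 < δ₀) (hδδ : δ ≤ δ₀ / 2)
    (hX : 0 ≤ X) : Real.exp (δ * X) - 1 ≤ δ * (2 / δ₀ * Real.exp (δ₀ * X)) := by
  have h1 : Real.exp (δ * X) - 1 ≤ δ * X * Real.exp (δ * X) := by
    have h2 := abs_exp_sub_exp_le (le_refl (δ * X)) (mul_nonneg hδ hX)
    rw [Real.exp_zero, sub_zero, abs_of_nonneg (mul_nonneg hδ hX)] at h2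
    exact (le_abs_self _).trans h2
  have h3 : X * Real.exp (δ * X) ≤ 2 / δ₀ * Real.exp (δ₀ * X) := by
    have h4 : Real.exp (δ * X) ≤ Real.exp (δ₀ / 2 * X) :=
      Real.exp_le_exp.2 (mul_le_mul_of_nonneg_right hδδ hX)
    refine (mul_le_mul_of_nonneg_left h4 hX).trans ?_
    have h5 := mul_exp_le (N := X) (show δ₀ / 2 < δ₀ by linarith)
    rwa [show (δ₀ - δ₀ / 2)⁻¹ = 2 / δ₀ by rw [sub_half, inv_div]] at h5
  rw [mul_assoc] at h1
  exact h1.trans (mul_le_mul_of_nonneg_left h3 hδ)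

/-- Let `u = n p`, so that `u t → β`. Then `k p t² = (u t)² / (2u)` and `n² p² t³ = (u t)³ / u` are
both `O(1 / u)`. Below criticality an exponent `b' - b` is left to absorb the overlap term, so the
ratio itself is `O(1 / u)`. -/
theorem tendsto_relativeVariance (hβ : 0 < β) (ha0 : 0 ≤ a) (hβa : β * (1 + a) < 2)
    (hp0 : ∀ k, 0 ≤ p k) (hα0 : ∀ k, 0 ≤ α k) (hα1 : ∀ k, α k ≤ 1)
    (hnp : Tendsto (fun k : ℕ => ((2 * k : ℕ) : ℝ) * p k) atTop atTop)
    (hα : Tendsto α atTop (𝓝 a)) :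
    Tendsto (fun k => relativeVariance k (p k) (α k) (tanhParameter β p k)) atTop (𝓝 0) := by
  obtain ⟨b', hb'0, hb'⟩ : ∃ b', β * (1 + a) / 4 < b' ∧ b' < 1 / 2 := exists_between (by linarith)
  obtain ⟨b, hb0, hbb'⟩ := exists_between hb'0
  have hb : 0 ≤ b := le_trans (by positivity) hb0.le
  have hL : 0 < 2 * β := by linarith
  -- `A` and `B` come from `u t ≤ 2 β`, valid eventually; `δ₀` is set so that `δ₀ A = b' - b`, the
  -- spare exponent.
  set A := (2 * β) ^ 2 / 2 with hA
  set B := 20 * (2 * β) ^ 3 with hB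
  have hA0 : 0 < A := by positivity
  have hB0 : 0 < B := by positivity
  set δ₀ := (b' - b) / A with hδ₀
  have hδ₀0 : 0 < δ₀ := div_pos (sub_pos.2 hbb') hA0
  obtain ⟨K, hK⟩ := exists_sum_sum_exp_quadForm_le hb hbb'.le (by linarith)
  have hs := tendsto_natCast_mul_tanhParameter (β := β) hnp
  have hr := tendsto_natCast_mul_mul_tanhParameter (β := β) hnp hα
  have hcs := ((tendsto_natCast_mul_artanh hs).add (tendsto_natCast_mul_artanh hr)).div_const 2
  have hδ : Tendsto (fun k : ℕ => (((2 * k : ℕ) : ℝ) * p k)⁻¹) atTop (𝓝 0) :=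
    tendsto_inv_atTop_zero.comp hnp
  have hbound : Tendsto (fun k : ℕ => (((2 * k : ℕ) : ℝ) * p k)⁻¹ *
      (2 / δ₀ * Real.exp (δ₀ * B) * K)) atTop (𝓝 0) := by
    simpa using hδ.mul_const (2 / δ₀ * Real.exp (δ₀ * B) * K)
  refine squeeze_zero' ?_ ?_ hbound
  · filter_upwards [eventually_mem_Ioo_of_tendsto_natCast_mul hs,
      eventually_mem_Ioo_of_tendsto_natCast_mul hr, hnp.eventually_gt_atTop 0] with k h1 h2 h3
    have ht : 0 ≤ tanhParameter β p k := tanh_nonneg (div_nonneg hβ.le h3.le)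
    refine div_nonneg (Finset.sum_nonneg fun σ _ => Finset.sum_nonneg fun τ _ =>
      mul_nonneg (mul_pos (annealedWeight_pos h1 h2 σ) (annealedWeight_pos h1 h2 τ)).le ?_)
      (sq_nonneg _)
    rw [sub_nonneg, Real.one_le_exp_iff]
    have := quadForm_one_nonneg (scaledMagnetization (2 * k) (σ * τ))
    have := hp0 k
    positivity
  filter_upwards [eventually_mem_Ioo_of_tendsto_natCast_mul hs,
    eventually_mem_Ioo_of_tendsto_natCast_mul hr, hnp.eventually_gt_atTop 0,
    eventually_gt_atTop 0, hcs.eventually_lt_const (show _ < b by linarith),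
    hδ.eventually_le_const (half_pos hδ₀0),
    (tendsto_mul_tanhParameter (β := β) hnp).eventually_le_const (show β < 2 * β by linarith)]
    with k h1 h2 hnpk hk hcb hδk htk
  have ht : 0 ≤ tanhParameter β p k := tanh_nonneg (div_nonneg hβ.le hnpk.le)
  set t := tanhParameter β p k
  set u := ((2 * k : ℕ) : ℝ) * p k with hu
  have hk' : (0 : ℝ) < k := by exact_mod_cast hk
  have hpt : 0 ≤ p k * t := mul_nonneg (hp0 k) ht
  have hrs : α k * p k * t ≤ p k * t := by
    rw [mul_assoc]; exact mul_le_of_le_one_left hpt (hα1 k)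
  have hr0 : 0 ≤ α k * p k * t := by
    rw [mul_assoc]; exact mul_nonneg (hα0 k) hpt
  have hart : Real.artanh (α k * p k * t) ≤ Real.artanh (p k * t) :=
    Real.artanh_le_artanh h2.1 h1.2 hrs
  have hart0 : 0 ≤ Real.artanh (α k * p k * t) := Real.artanh_nonneg hr0
  obtain ⟨C, hC, hw⟩ := exists_annealedWeight_eq hk h1 h2
  set c := (k : ℝ) * (Real.artanh (p k * t) + Real.artanh (α k * p k * t)) / 2
  set d := (k : ℝ) * (Real.artanh (p k * t) - Real.artanh (α k * p k * t)) / 2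
  have hd0 : 0 ≤ d := div_nonneg (mul_nonneg hk'.le (sub_nonneg.2 hart)) (by norm_num)
  have hcd : d ≤ c := by
    refine div_le_div_of_nonneg_right (mul_le_mul_of_nonneg_left ?_ hk'.le) (by norm_num)
    linarith
  have hcb' : c ≤ b := by
    have : c = ((k : ℝ) * Real.artanh (p k * t) + (k : ℝ) * Real.artanh (α k * p k * t)) / 2 := by
      simp only [c]; ring
    rw [this]; exact hcb.le
  set N : Config (2 * k) → ℝ := fun σ => quadForm 1 1 (scaledMagnetization (2 * k) σ)
  have hN : ∀ σ, 0 ≤ N σ := fun σ => quadForm_one_nonneg _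
  have hwle : ∀ σ, annealedWeight (2 * k) (p k * t) (α k * p k * t) σ ≤ C * Real.exp (b * N σ) := by
    intro σ
    rw [hw]
    exact mul_le_mul_of_nonneg_left (Real.exp_le_exp.2 (quadForm_le hcb' (hcd.trans hcb') _)) hC.le
  -- The annealed exponent is nonnegative, so the denominator needs no limit theorem.
  have hwge : C * 2 ^ (2 * k) ≤
      ∑ σ, annealedWeight (2 * k) (p k * t) (α k * p k * t) σ := by
    have h3 : ∑ σ : Config (2 * k), C ≤
        ∑ σ, annealedWeight (2 * k) (p k * t) (α k * p k * t) σ := by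
      refine Finset.sum_le_sum fun σ _ => ?_
      rw [hw]
      exact le_mul_of_one_le_right hC.le
        (Real.one_le_exp (quadForm_nonneg (hd0.trans hcd) hd0 _))
    refine le_trans (le_of_eq ?_) h3
    simp [mul_comm]
  have hwpos := annealedWeight_pos (n := 2 * k) h1 h2
  have hexp : ∀ σ τ : Config (2 * k), Real.exp (k * p k * t ^ 2 * N (σ * τ) +
      20 * (2 * k : ℕ) ^ 2 * p k ^ 2 * t ^ 3) - 1 ≤
      u⁻¹ * (2 / δ₀ * Real.exp (δ₀ * B)) * Real.exp ((b' - b) * N (σ * τ)) := by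
    intro σ τ
    have hut : 0 ≤ u * t := mul_nonneg hnpk.le ht
    have e1 : k * p k * t ^ 2 ≤ u⁻¹ * A := by
      have : k * p k * t ^ 2 = u⁻¹ * ((u * t) ^ 2 / 2) := by
        rw [show (k : ℝ) * p k = u / 2 by rw [hu]; push_cast; ring]
        field_simp
      rw [this, hA]
      gcongr
    have e2 : 20 * (2 * k : ℕ) ^ 2 * p k ^ 2 * t ^ 3 ≤ u⁻¹ * B := by
      have : 20 * (2 * k : ℕ) ^ 2 * p k ^ 2 * t ^ 3 = u⁻¹ * (20 * (u * t) ^ 3) := by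
        rw [show 20 * ((2 * k : ℕ) : ℝ) ^ 2 * p k ^ 2 * t ^ 3 = 20 * u ^ 2 * t ^ 3 by
          rw [hu]; ring]
        field_simp
      rw [this, hB]
      gcongr
    have e3 : k * p k * t ^ 2 * N (σ * τ) + 20 * (2 * k : ℕ) ^ 2 * p k ^ 2 * t ^ 3 ≤
        u⁻¹ * (A * N (σ * τ) + B) := by
      have := mul_le_mul_of_nonneg_right e1 (hN (σ * τ))
      linarith
    have e4 := exp_mul_sub_one_le (inv_nonneg.2 hnpk.le) hδ₀0 hδk
      (show 0 ≤ A * N (σ * τ) + B by have := hN (σ * τ); positivity)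
    have e5 : Real.exp (δ₀ * (A * N (σ * τ) + B)) =
        Real.exp (δ₀ * B) * Real.exp ((b' - b) * N (σ * τ)) := by
      rw [← Real.exp_add]
      congr 1
      rw [mul_add, ← mul_assoc, hδ₀, div_mul_cancel₀ _ hA0.ne']
      ring
    rw [e5] at e4
    have e6 := Real.exp_le_exp.2 e3
    refine (sub_le_sub_right e6 1).trans (e4.trans (le_of_eq ?_))
    ring
  rw [relativeVariance, div_le_iff₀ (pow_pos (lt_of_lt_of_le (by positivity) hwge) 2)]
  set D := u⁻¹ * (2 / δ₀ * Real.exp (δ₀ * B)) with hD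
  have hD0 : 0 ≤ D := by positivity
  have hK0 : 0 ≤ K := by
    have h3 := hK k hk
    have h4 : 0 ≤ (2 ^ (2 * k)) ^ 2 * K :=
      le_trans (Finset.sum_nonneg fun σ _ => Finset.sum_nonneg fun τ _ => (Real.exp_pos _).le) h3
    exact nonneg_of_mul_nonneg_right h4 (by positivity)
  calc _ ≤ ∑ σ : Config (2 * k), ∑ τ : Config (2 * k), C ^ 2 * D *
        Real.exp (b * (N σ + N τ) + (b' - b) * N (σ * τ)) := by
        refine Finset.sum_le_sum fun σ _ => Finset.sum_le_sum fun τ _ => ?_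
        refine (mul_le_mul_of_nonneg_left (hexp σ τ)
          (mul_pos (hwpos σ) (hwpos τ)).le).trans ?_
        refine (mul_le_mul_of_nonneg_right (mul_le_mul (hwle σ) (hwle τ) (hwpos τ).le
          (mul_nonneg hC.le (Real.exp_pos _).le)) (mul_nonneg hD0 (Real.exp_pos _).le)).trans
          (le_of_eq ?_)
        rw [Real.exp_add, mul_add, Real.exp_add]
        ring
    _ = C ^ 2 * D * ∑ σ : Config (2 * k), ∑ τ : Config (2 * k),
        Real.exp (b * (N σ + N τ) + (b' - b) * N (σ * τ)) := by
        simp_rw [← Finset.mul_sum]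
    _ ≤ C ^ 2 * D * ((2 ^ (2 * k)) ^ 2 * K) := by
        gcongr
        exact hK k hk
    _ = D * K * (C * 2 ^ (2 * k)) ^ 2 := by ring
    _ ≤ D * K * (∑ σ, annealedWeight (2 * k) (p k * t) (α k * p k * t) σ) ^ 2 := by
        gcongr
    _ = _ := by rw [hD]; ring

end Asymptotics

/-! ### From concentration to convergence of Gibbs averages -/

theorem abs_div_sub_lt {x y m l η δ B : ℝ} (hη0 : 0 ≤ η) (hη : η ≤ 1 / 2) (hB : |m| ≤ B)
    (hηδ : 4 * η * (1 + B) ≤ δ) (hx : |x - m| < η) (hy : |y - 1| < η) (hm : |m - l| < δ / 2) :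
    |x / y - l| < δ := by
  have hy' := abs_lt.1 hy
  have hy0 : 1 / 2 < y := by linarith
  have h1 : |x / y - m| ≤ δ / 2 := by
    rw [div_sub' (by linarith : y ≠ 0), abs_div, abs_of_pos (by linarith : 0 < y),
      div_le_iff₀ (by linarith)]
    have h2 : x - y * m = (x - m) - (y - 1) * m := by ring
    have h3 : |x - y * m| ≤ η + η * B := by
      rw [h2]
      refine (abs_sub _ _).trans (add_le_add hx.le ?_)
      rw [abs_mul]
      exact mul_le_mul hy.le hB (abs_nonneg _) hη0
    have hδ : 0 ≤ δ := le_trans (mul_nonneg (by linarith)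
      (by linarith [(abs_nonneg m).trans hB])) hηδ
    nlinarith
  have h2 : |x / y - l| ≤ |x / y - m| + |m - l| := abs_sub_le _ _ _
  linarith

section Convergence

variable {Ω : Type*} [MeasurableSpace Ω] {P : Measure Ω} [IsProbabilityMeasure P]

/-- The Gibbs average of `f` is a quotient of two weighted sums. Divided by the annealed partition
function, they concentrate at the annealed average of `f` and at `1`. -/
theorem tendsto_measure_integral_sub_of_nonneg {p α : ℕ → unitInterval}
    {a β : ℝ} (hβ : 0 < β) (ha0 : 0 ≤ a) (hβa : β * (1 + a) < 2)
    (hnp : Tendsto (fun k : ℕ => ((2 * k : ℕ) : ℝ) * (p k : ℝ)) atTop atTop)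
    (hα : Tendsto (fun k => (α k : ℝ)) atTop (𝓝 a))
    {ξ : ∀ k : ℕ, internalEdges (2 * k) → Ω → ℝ} {ζ : ∀ k : ℕ, externalEdges (2 * k) → Ω → ℝ}
    (hgraph : ∀ k, IsBlockModel P (2 * k) (p k) (α k) (ξ k) (ζ k))
    (f : BoundedContinuousFunction (EuclideanSpace ℝ (Fin 2)) ℝ) (hf : ∀ y, 0 ≤ f y) {δ : ℝ}
    (hδ : 0 < δ) :
    Tendsto (fun k => P {ω | δ ≤ |∫ y, f y ∂(scaledMagnetizationLaw (2 * k) (p k) β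
        (fun e => ξ k e ω) (fun e => ζ k e ω) : Measure (EuclideanSpace ℝ (Fin 2))) -
      ∫ y, f y ∂(centeredGaussian (limitCov β a) : Measure (EuclideanSpace ℝ (Fin 2)))|})
      atTop (𝓝 0) := by
  set l := ∫ y, f y ∂(centeredGaussian (limitCov β a) : Measure (EuclideanSpace ℝ (Fin 2)))
  set t : ℕ → ℝ := tanhParameter β (fun k => (p k : ℝ))
  have hs := tendsto_natCast_mul_tanhParameter (β := β) hnp
  have hr := tendsto_natCast_mul_mul_tanhParameter (β := β) hnp hα
  have hV := tendsto_relativeVariance hβ ha0 hβa (fun k => (p k).2.1) (fun k => (α k).2.1)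
    (fun k => (α k).2.2) hnp hα
  have hmean := tendsto_sum_annealedWeight_div hβ ha0 hβa
    (eventually_mem_Ioo_of_tendsto_natCast_mul hs) (eventually_mem_Ioo_of_tendsto_natCast_mul hr)
    (tendsto_natCast_mul_artanh hs) (tendsto_natCast_mul_artanh hr) f
  obtain ⟨η, hη0, hη1, hη⟩ : ∃ η > 0, η ≤ 1 / 2 ∧ 4 * η * (1 + ‖f‖) ≤ δ := by
    have h1 : 0 < 1 + ‖f‖ := by positivity
    refine ⟨min (1 / 2) (δ / (4 * (1 + ‖f‖))), by positivity, min_le_left _ _, ?_⟩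
    have := min_le_right (1 / 2) (δ / (4 * (1 + ‖f‖)))
    rw [le_div_iff₀ (by positivity)] at this
    linarith
  have hupper : Tendsto (fun k =>
      ENNReal.ofReal (‖f‖ ^ 2 * relativeVariance k (p k) (α k) (t k) / η ^ 2) +
      ENNReal.ofReal (1 ^ 2 * relativeVariance k (p k) (α k) (t k) / η ^ 2)) atTop (𝓝 0) := by
    have h1 := ENNReal.tendsto_ofReal ((hV.const_mul (‖f‖ ^ 2)).div_const (η ^ 2))
    have h2 := ENNReal.tendsto_ofReal ((hV.const_mul (1 ^ 2)).div_const (η ^ 2))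
    simpa using h1.add h2
  refine tendsto_of_tendsto_of_tendsto_of_le_of_le' tendsto_const_nhds hupper
    (.of_forall fun _ => zero_le) ?_
  filter_upwards [eventually_gt_atTop 0, hnp.eventually_gt_atTop 0,
    eventually_mem_Ioo_of_tendsto_natCast_mul hs, eventually_mem_Ioo_of_tendsto_natCast_mul hr,
    (tendsto_zero_of_tendsto_natCast_mul hs).eventually_le_const (show (0 : ℝ) < 1 / 2 by norm_num),
    Metric.tendsto_nhds.1 hmean (δ / 2) (half_pos hδ)] with k hk hnpk h1 h2 hpt hm
  have ht0 : 0 ≤ t k := tanh_nonneg (div_nonneg hβ.le hnpk.le)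
  have ht1 : t k ≤ 1 := (Real.tanh_lt_one _).le
  set w := annealedWeight (2 * k) (p k * t k) (α k * p k * t k)
  set F : Config (2 * k) → ℝ := fun σ => f (scaledMagnetization (2 * k) σ)
  have hFB : ∀ σ, F σ ≤ ‖f‖ := fun σ => (le_abs_self _).trans (f.norm_coe_le_norm _)
  have hwpos : ∀ σ, 0 < w σ := annealedWeight_pos h1 h2
  have hM : 0 < ∑ σ, w σ := Finset.sum_pos (fun σ _ => hwpos σ) Finset.univ_nonempty
  have hP1 := (hgraph k).measureReal_le hk ht0 ht1 hpt (F := F) (fun σ => hf _) hFB hη0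
  have hP2 := (hgraph k).measureReal_le hk ht0 ht1 hpt (F := fun _ => 1) (fun _ => zero_le_one)
    (fun _ => le_rfl) hη0
  have hP1' := ENNReal.ofReal_le_ofReal hP1
  have hP2' := ENNReal.ofReal_le_ofReal hP2
  rw [ofReal_measureReal] at hP1' hP2'
  refine le_trans ?_ (add_le_add hP1' hP2')
  -- The inclusion is only almost sure: the expansion needs indicators with values in `{0, 1}`.
  refine le_trans (measure_mono_ae ?_) (measure_union_le _ _)
  filter_upwards [(hgraph k).ae_internal, (hgraph k).ae_external] with ω hω1 hω2 hω
  by_contra hnot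
  set q : Config (2 * k) → ℝ :=
    quenchedWeight (2 * k) (t k) (fun e => ξ k e ω) (fun e => ζ k e ω) with hq
  have hn1 : |∑ σ, F σ * q σ - ∑ σ, F σ * w σ| < η * ∑ σ, w σ :=
    not_le.1 fun h => hnot (Or.inl h)
  have hn2 : |∑ σ, 1 * q σ - ∑ σ, 1 * w σ| < η * ∑ σ, w σ :=
    not_le.1 fun h => hnot (Or.inr h)
  simp only [one_mul] at hn2
  set M := ∑ σ, w σ
  have hx : |(∑ σ, F σ * q σ) / M - (∑ σ, F σ * w σ) / M| < η := by
    rw [← sub_div, abs_div, abs_of_pos hM, div_lt_iff₀ hM]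
    exact hn1
  have hy : |(∑ σ, q σ) / M - 1| < η := by
    rw [div_sub_one hM.ne', abs_div, abs_of_pos hM, div_lt_iff₀ hM]
    exact hn2
  have hmB : |(∑ σ, F σ * w σ) / M| ≤ ‖f‖ := by
    rw [abs_of_nonneg (div_nonneg (Finset.sum_nonneg fun σ _ => mul_nonneg (hf _) (hwpos σ).le)
      hM.le), div_le_iff₀ hM, Finset.mul_sum]
    exact Finset.sum_le_sum fun σ _ => mul_le_mul_of_nonneg_right (hFB σ) (hwpos σ).le
  have hint : ∫ y, f y ∂(scaledMagnetizationLaw (2 * k) (p k) β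
      (fun e => ξ k e ω) (fun e => ζ k e ω) : Measure (EuclideanSpace ℝ (Fin 2))) =
      (∑ σ, F σ * q σ) / M / ((∑ σ, q σ) / M) := by
    rw [integral_scaledMagnetizationLaw _ _ _ _ _ f.continuous, div_div_div_cancel_right₀ hM.ne',
      Finset.sum_div]
    refine Finset.sum_congr rfl fun σ _ => ?_
    rw [gibbsWeight_eq_quenchedWeight_div _ _ _ hω1 hω2, smul_eq_mul, mul_comm, ← mul_div_assoc]
    rfl
  have hlt := abs_div_sub_lt hη0.le hη1 hmB hη hx hy (l := l) hm
  rw [← hint] at hlt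
  exact absurd hlt (not_lt.2 hω)

end Convergence

end BlockIsing

end

theorem theorem2 {Ω : Type*} [MeasurableSpace Ω] (P : Measure Ω) [IsProbabilityMeasure P]
    (p α : ℕ → unitInterval) (hp : ∀ n, 0 < p n)
    (hnp : Tendsto (fun n : ℕ => (n : ℝ) * (p n : ℝ)) atTop atTop)
    (a : ℝ) (hα : Tendsto (fun n : ℕ => (α n : ℝ)) atTop (𝓝 a))
    (ξ : ∀ n : ℕ, BlockIsing.internalEdges n → Ω → ℝ)
    (ζ : ∀ n : ℕ, BlockIsing.externalEdges n → Ω → ℝ)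
    (hgraph : ∀ n : ℕ, Even n → BlockIsing.IsBlockModel P n (p n) (α n) (ξ n) (ζ n))
    (β : ℝ) (hβ : 0 < β) (hβc : β < BlockIsing.criticalBeta a) :
    (BlockIsing.limitCov β a).PosSemidef ∧
    BlockIsing.TendstoInProbability P
      (fun k ω => BlockIsing.scaledMagnetizationLaw (2 * k) (p (2 * k)) β
        (fun e => ξ (2 * k) e ω) (fun e => ζ (2 * k) e ω))
      (BlockIsing.centeredGaussian (BlockIsing.limitCov β a)) := by
  have ha0 : 0 ≤ a := ge_of_tendsto' hα fun n => (α n).2.1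
  have hβa : β * (1 + a) < 2 := by
    rwa [BlockIsing.criticalBeta, lt_div_iff₀ (by linarith)] at hβc
  have hdouble : Tendsto (fun k : ℕ => 2 * k) atTop atTop :=
    tendsto_id.const_mul_atTop' (by norm_num)
  refine ⟨BlockIsing.limitCov_posSemidef hβ ha0 hβa,
    BlockIsing.tendstoInProbability_of_forall_integral _ _ _ fun f δ hδ => ?_⟩
  have h := BlockIsing.tendsto_measure_integral_sub_of_nonneg hβ ha0 hβa (hnp.comp hdouble)
    (hα.comp hdouble) (fun k => hgraph (2 * k) (even_two_mul k))
    -- The shift makes the test function nonnegative, and it cancels in the difference of integrals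
    -- against probability measures.
    (f + BoundedContinuousFunction.const _ ‖f‖)
    (fun y => by
      have := neg_le_of_abs_le (f.norm_coe_le_norm y)
      simp only [BoundedContinuousFunction.coe_add, Pi.add_apply,
        BoundedContinuousFunction.const_apply]
      linarith) hδ
  have hadd : ∀ μ : ProbabilityMeasure (EuclideanSpace ℝ (Fin 2)),
      ∫ y, (f + BoundedContinuousFunction.const (EuclideanSpace ℝ (Fin 2)) ‖f‖) y
        ∂(μ : Measure (EuclideanSpace ℝ (Fin 2))) =
        ∫ y, f y ∂(μ : Measure (EuclideanSpace ℝ (Fin 2))) + ‖f‖ := by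
    intro μ
    simp only [BoundedContinuousFunction.coe_add, Pi.add_apply,
      BoundedContinuousFunction.const_apply]
    rw [integral_add (f.integrable _) (integrable_const _)]
    simp
  simpa only [hadd, add_sub_add_right_eq_sub] using h
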